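/- Let $R$ be a commutative artinian ring, $A$ an Artin $R$-algebra (an $R$-algebra that is finitely generated as an $R$-module), $n\ge 2$, and $T_n(A)$ the Artin $R$-algebra of upper triangular $n\times n$ matrices over $A$, with matrix units $e_{ij}$ $(i\le j)$. For an Artin $R$-algebra $\Lambda$ let $D(\Lambda_\Lambda)=\operatorname{Hom}_R(\Lambda,J)$, where $J$ is the injective envelope of $R/\operatorname{rad}R$, with the left $\Lambda$-action $(af)(x)=f(xa)$. A left $T_n(A)$-module $X$ is identified with the chain of $A$-modules $X_n\xrightarrow{\phi_{n-1}}X_{n-1}\to\cdots\xrightarrow{\phi_1}X_1$, where $X_i=e_{ii}X$ and $\phi_i$ is multiplication by $e_{i,i+1}$. The monomorphism category $\mathcal S_n(A)$ is the full subcategory of all finitely generated left $T_n(A)$-modules $X$ such that $\phi_1,\dots,\phi_{n-1}$ are all monomorphisms. For a left $A$-module $M$ let $\mathbf m_i(M)$ be the $T_n(A)$-module of column vectors $(M,\dots,M,0,\dots,0)^T$ with $i$ entries $M$ (all maps between consecutive entries $M$ being identities), and $\mathbf m(M)=\bigoplus_{i=1}^n\mathbf m_i(M)$. For a finitely generated left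 $\Lambda$-module $T$, let ${}^\perp T$ be the full subcategory of all finitely generated left $\Lambda$-modules $X$ with $\operatorname{Ext}^i_\Lambda(X,T)=0$ for all $i\ge1$, and let $\operatorname{add}(T)$ consist of the direct summands of finite direct sums of copies of $T$. Call $T$ $r$-cotilting if $\operatorname{inj.dim}T\le r$, $\operatorname{Ext}^i_\Lambda(T,T)=0$ for all $i\ge1$, and there is an exact sequence $0\to T_s\to\cdots\to T_0\to D(\Lambda_\Lambda)\to0$ with all $T_i\in\operatorname{add}(T)$; call $T$ cotilting if it is $r$-cotilting for some $r\ge 0$. Then: 1. $\mathcal S_n(A)={}^\perp\mathbf m(D(A_A))$. 2. $\mathbf m(D(A_A))$ is a ($1$-)cotilting $T_n(A)$-module (in particular finitely generated), and $\operatorname{inj.dim}\mathbf m(D(A_A))=1$ if $A\ne0$. 3. $\operatorname{End}_{T_n(A)}(\mathbf m(D(A_A)))\cong T_n(A)^{op}$ as rings. 4. $\mathbf m(D(A_A))$ is, up to multiplicities of indecomposable direct summands, the only cotilting $T_n(A)$-module $C$ with $\mathcal S_n(A)={}^\perp C$: for every such $C$, an indecomposable $T_n(A)$-module is isomorphic to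 a direct summand of $C$ if and only if it is isomorphic to a direct summand of $\mathbf m(D(A_A))$. -/

import Mathlib

universe u

/-! ### Injective envelopes -/

section InjectiveEnvelope

variable {R : Type u} [Ring R] {M E : Type u} [AddCommGroup M] [Module R M]
  [AddCommGroup E] [Module R E]

/-- `i : M → E` is an injective envelope of `M`: the module `E` is injective, and `i` is an
essential monomorphism. -/
structure IsInjectiveEnvelope (i : M →ₗ[R] E) : Prop where
  injective_module : Module.Injective R E
  injective : Function.Injective i
  essential : ∀ N : Submodule R E, N ⊓ LinearMap.range i = ⊥ → N = ⊥

/-- Every module has an injective envelope. -/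
theorem exists_isInjectiveEnvelope (R : Type u) [Ring R] (M : Type u) [AddCommGroup M]
    [Module R M] :
    ∃ (E : ModuleCat.{u} R) (i : M →ₗ[R] E), IsInjectiveEnvelope i := by
  -- embed `M` into an injective module `I`
  obtain ⟨I, hI, f, hf⟩ : ∃ (I : ModuleCat.{u} R) (_ : Module.Injective R I) (f : M →ₗ[R] I),
      Function.Injective f := by
    let p := CategoryTheory.Injective.under (ModuleCat.of R M)
    refine ⟨p, Module.injective_module_of_injective_object R p
        (inj := inferInstanceAs (CategoryTheory.Injective (CategoryTheory.Injective.under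
          (ModuleCat.of R M)))),
      (CategoryTheory.Injective.ι (ModuleCat.of R M)).hom, ?_⟩
    exact (ModuleCat.mono_iff_injective _).mp inferInstance
  -- a maximal essential extension `E` of the image of `M` in `I`
  obtain ⟨E, hle, hE⟩ := zorn_le_nonempty₀
    {N : Submodule R I | LinearMap.range f ≤ N ∧
      ∀ K : Submodule R I, K ≤ N → K ⊓ LinearMap.range f = ⊥ → K = ⊥}
    (by
      intro c hc hchain y hy
      refine ⟨sSup c, ⟨(hc hy).1.trans (le_sSup hy), ?_⟩, fun z hz => le_sSup hz⟩
      intro K hK hKf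
      rw [Submodule.eq_bot_iff]
      intro x hx
      obtain ⟨N, hN, hxN⟩ := (Submodule.mem_sSup_of_directed ⟨y, hy⟩ hchain.directedOn).mp (hK hx)
      have h1 : Submodule.span R {x} ≤ N := by
        rw [Submodule.span_le]
        simpa using hxN
      have h2 : Submodule.span R {x} ≤ K := by
        rw [Submodule.span_le]
        simpa using hx
      have h3 := (hc hN).2 _ h1 (le_bot_iff.mp (hKf ▸ inf_le_inf_right _ h2))
      simpa using h3)
    (LinearMap.range f) ⟨le_rfl, fun K hK h => by rwa [inf_eq_left.mpr hK] at h⟩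
  -- a maximal submodule `C` of `I` that meets `E` trivially
  obtain ⟨C, -, hC⟩ := zorn_le_nonempty₀ {N : Submodule R I | N ⊓ E = ⊥}
    (by
      intro c hc hchain y hy
      refine ⟨sSup c, ?_, fun z hz => le_sSup hz⟩
      change sSup c ⊓ E = ⊥
      rw [Submodule.eq_bot_iff]
      rintro x ⟨hx, hxE⟩
      obtain ⟨N, hN, hxN⟩ := (Submodule.mem_sSup_of_directed ⟨y, hy⟩ hchain.directedOn).mp hx
      have h : N ⊓ E = ⊥ := hc hN
      exact (Submodule.eq_bot_iff _).mp h x ⟨hxN, hxE⟩)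
    ⊥ (by simp)
  have hCE : C ⊓ E = ⊥ := hC.prop
  let π : E →ₗ[R] (I ⧸ C) := C.mkQ ∘ₗ E.subtype
  have hπ : Function.Injective π := by
    rw [← LinearMap.ker_eq_bot, Submodule.eq_bot_iff]
    intro x hx
    have hx' : (x : I) ∈ C := by simpa [π] using hx
    exact Subtype.ext ((Submodule.eq_bot_iff _).mp hCE x ⟨hx', x.2⟩)
  obtain ⟨g, hg⟩ := hI.out π hπ E.subtype
  have hgπ : ∀ x ∈ E, g (C.mkQ x) = x := fun x hx => hg ⟨x, hx⟩
  have hginj : Function.Injective g := by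
    rw [← LinearMap.ker_eq_bot]
    have hcomap : (LinearMap.ker g).comap C.mkQ = C := by
      have hCle : C ≤ (LinearMap.ker g).comap C.mkQ := by
        intro x hx
        have : C.mkQ x = 0 := by simpa using hx
        simp [Submodule.mem_comap, this]
      refine le_antisymm (hC.le_of_ge ?_ hCle) hCle
      change _ ⊓ E = ⊥
      rw [Submodule.eq_bot_iff]
      rintro x ⟨hx, hxE⟩
      have h0 : g (C.mkQ x) = 0 := hx
      rw [← hgπ x hxE, h0]
    rw [Submodule.eq_bot_iff]
    intro y hy
    obtain ⟨x, rfl⟩ := C.mkQ_surjective y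
    have : x ∈ C := hcomap ▸ hy
    simpa using this
  have hrange : LinearMap.range g ≤ E := by
    refine hE.le_of_ge ⟨?_, ?_⟩ ?_
    · exact fun x hx => ⟨C.mkQ x, hgπ x (hle hx)⟩
    · intro K hK hKf
      have h1 : K ⊓ E = ⊥ :=
        hE.prop.2 _ inf_le_right (le_bot_iff.mp (hKf ▸ inf_le_inf_right _ inf_le_left))
      have h2 : ((K.comap g).comap C.mkQ) = C := by
        have hCle : C ≤ (K.comap g).comap C.mkQ := by
          intro x hx
          have : C.mkQ x = 0 := by simpa using hx
          simp [Submodule.mem_comap, this]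
        refine le_antisymm (hC.le_of_ge ?_ hCle) hCle
        change _ ⊓ E = ⊥
        rw [Submodule.eq_bot_iff]
        rintro x ⟨hx, hxE⟩
        have hxK : g (C.mkQ x) ∈ K := hx
        rw [hgπ x hxE] at hxK
        exact (Submodule.eq_bot_iff _).mp h1 x ⟨hxK, hxE⟩
      rw [Submodule.eq_bot_iff]
      intro y hy
      obtain ⟨z, rfl⟩ := hK hy
      obtain ⟨x, rfl⟩ := C.mkQ_surjective z
      have hxC : x ∈ C := h2 ▸ (show x ∈ (K.comap g).comap C.mkQ from hy)
      have : C.mkQ x = 0 := by simpa using hxC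
      rw [this, map_zero]
    · exact fun x hx => ⟨C.mkQ x, hgπ x hx⟩
  let r : I →ₗ[R] E := (g ∘ₗ C.mkQ).codRestrict E fun x => hrange ⟨_, rfl⟩
  have hr : ∀ x : E, r x = x := fun x => Subtype.ext (hgπ x x.2)
  refine ⟨ModuleCat.of R E, f.codRestrict E fun x => hle ⟨x, rfl⟩, ⟨?_, ?_, ?_⟩⟩
  · refine ⟨fun X Y _ _ _ _ a ha b => ?_⟩
    obtain ⟨h, hh⟩ := hI.out a ha (E.subtype ∘ₗ b)
    refine ⟨r ∘ₗ h, fun x => ?_⟩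
    rw [LinearMap.comp_apply, hh]
    exact hr _
  · exact fun x y hxy => hf (congrArg Subtype.val hxy)
  · intro N hN
    have h := hE.prop.2 (N.map E.subtype) (Submodule.map_subtype_le _ _) (by
      rw [Submodule.eq_bot_iff]
      rintro _ ⟨⟨x, hx, rfl⟩, ⟨m, hm⟩⟩
      have := (Submodule.eq_bot_iff _).mp hN x ⟨hx, ⟨m, Subtype.ext hm⟩⟩
      rw [this, map_zero])
    exact Submodule.map_injective_of_injective E.injective_subtype (h.trans (Submodule.map_bot _).symm)

/-- The injective envelope of a module. -/
noncomputable def injectiveEnvelope (R : Type u) [Ring R] (M : Type u) [AddCommGroup M]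
    [Module R M] : ModuleCat.{u} R :=
  (exists_isInjectiveEnvelope R M).choose

end InjectiveEnvelope

/-! ### The duality of an Artin algebra -/

section Duality

/-- `D(A_A) = Hom_R(A, J)`, where `J` is the injective envelope of the `R`-module `R / rad R`. -/
def DualRegular (R A : Type u) [CommRing R] [Ring A] [Algebra R A] : Type u :=
  A →ₗ[R] injectiveEnvelope R (R ⧸ Ring.jacobson R)

variable (R A : Type u) [CommRing R] [Ring A] [Algebra R A]

noncomputable instance : AddCommGroup (DualRegular R A) :=
  inferInstanceAs (AddCommGroup (A →ₗ[R] injectiveEnvelope R (R ⧸ Ring.jacobson R)))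

/-- The left `A`-module structure on `D(A_A)`: `(a • f) x = f (x * a)`. -/
noncomputable instance : Module A (DualRegular R A) where
  smul a f := LinearMap.comp (show A →ₗ[R] _ from f) (LinearMap.mulRight R a)
  one_smul f := LinearMap.ext fun x => congrArg (show A →ₗ[R] _ from f) (mul_one x)
  mul_smul a b f := LinearMap.ext fun x =>
    congrArg (show A →ₗ[R] _ from f) (mul_assoc x a b).symm
  smul_zero _ := rfl
  smul_add _ _ _ := rfl
  add_smul a b f := LinearMap.ext fun x =>
    (congrArg (show A →ₗ[R] _ from f) (mul_add x a b)).trans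
      (map_add (show A →ₗ[R] _ from f) (x * a) (x * b))
  zero_smul f := LinearMap.ext fun x =>
    (congrArg (show A →ₗ[R] _ from f) (mul_zero x)).trans (map_zero (show A →ₗ[R] _ from f))

theorem DualRegular.smul_apply (a : A) (f : DualRegular R A) (x : A) :
    (show A →ₗ[R] _ from a • f) x = (show A →ₗ[R] _ from f) (x * a) :=
  rfl

end Duality

/-! ### Direct summands, perpendicular categories, cotilting modules -/

section Cotilting

open CategoryTheory

variable {Λ : Type u} [Ring Λ]

/-- `N` is (isomorphic to) a direct summand of `M`. -/
def IsDirectSummand (N M : ModuleCat.{u} Λ) : Prop :=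
  ∃ N' : ModuleCat.{u} Λ, Nonempty ((N × N') ≃ₗ[Λ] M)

/-- `N ∈ add M`: it is a direct summand of a finite direct sum of copies of `M`. -/
def MemAdd (N M : ModuleCat.{u} Λ) : Prop :=
  ∃ k : ℕ, IsDirectSummand N (ModuleCat.of Λ (Fin k → M))

/-- A nonzero module that is not the direct sum of two nonzero submodules. -/
def IsIndecomposableModule (N : ModuleCat.{u} Λ) : Prop :=
  Nontrivial N ∧ ∀ P Q : Submodule Λ N, IsCompl P Q → P = ⊥ ∨ Q = ⊥

/-- The left perpendicular category of `M`, a full subcategory of the category of finitely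
generated modules: all finitely generated `X` with `Ext^i(X, M) = 0` for all `i ≥ 1`. -/
def leftPerp (M : ModuleCat.{u} Λ) : ObjectProperty (ModuleCat.{u} Λ) :=
  fun X => Module.Finite Λ X ∧ ∀ i : ℕ, 1 ≤ i → Subsingleton (Abelian.Ext X M i)

/-- There is an exact sequence `0 → T_s → ⋯ → T_0 → Z → 0` with all `T_i ∈ add T`
(continued by zeros to the left of `T_s`). -/
def HasFiniteAddResolution (T Z : ModuleCat.{u} Λ) : Prop :=
  ∃ (s : ℕ) (P : ℕ → ModuleCat.{u} Λ) (d : ∀ i, P (i + 1) →ₗ[Λ] P i) (ε : P 0 →ₗ[Λ] Z),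
    (∀ i ≤ s, MemAdd (P i) T) ∧ (∀ i, s < i → Subsingleton (P i)) ∧
    Function.Surjective ε ∧ Function.Exact (d 0) ε ∧ ∀ i, Function.Exact (d (i + 1)) (d i)

/-- A finitely generated module `T` over the Artin `R`-algebra `Λ` is `r`-cotilting if its
injective dimension is at most `r`, it has no self-extensions in positive degrees, and `D(Λ_Λ)`
has a finite resolution by modules in `add T`. -/
structure IsCotilting (R : Type u) [CommRing R] [Algebra R Λ] (r : ℕ) (T : ModuleCat.{u} Λ) :
    Prop where
  finite : Module.Finite Λ T
  injectiveDimension_le : injectiveDimension T ≤ r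
  ext_self : ∀ i : ℕ, 1 ≤ i → Subsingleton (Abelian.Ext T T i)
  resolution : HasFiniteAddResolution T (ModuleCat.of Λ (DualRegular R Λ))

end Cotilting

/-! ### Upper triangular matrices and the monomorphism category -/

section Monomorphism

open CategoryTheory

/-- The algebra `T_n(A)` of upper triangular `n × n` matrices over `A`. -/
abbrev UpperTri (R A : Type u) [CommRing R] [Ring A] [Algebra R A] (n : ℕ) : Type u :=
  Matrix.blockTriangularSubalgebra R A (id : Fin n → Fin n)

section

variable (R A : Type u) [CommRing R] [Ring A] [Algebra R A] {n : ℕ}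

/-- The matrix unit `e_{ij}`, for `i ≤ j`. -/
def UpperTri.unit (i j : Fin n) (h : i ≤ j) : UpperTri R A n :=
  ⟨Matrix.single i j 1, fun k l hlk => by
    refine Matrix.single_apply_of_ne _ _ _ _ _ ?_
    rintro ⟨rfl, rfl⟩
    exact absurd hlk (not_lt.mpr h)⟩

variable (n) in
/-- The diagonal embedding of `A` into `T_n(A)`, through which `T_n(A)`-modules are
`A`-modules. -/
def UpperTri.diag : A →+* UpperTri R A n :=
  (Matrix.scalar (Fin n)).codRestrict (Matrix.blockTriangularSubalgebra R A (id : Fin n → Fin n))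
    fun _ => Matrix.blockTriangular_diagonal _

theorem UpperTri.unit_mul_diag (i j : Fin n) (h : i ≤ j) (a : A) :
    UpperTri.unit R A i j h * UpperTri.diag R A n a =
      UpperTri.diag R A n a * UpperTri.unit R A i j h := by
  refine Subtype.ext ?_
  change Matrix.single i j (1 : A) * Matrix.scalar (Fin n) a =
    Matrix.scalar (Fin n) a * Matrix.single i j (1 : A)
  ext k l
  simp [Matrix.scalar_apply, Matrix.mul_diagonal, Matrix.diagonal_mul, Matrix.single_apply]

theorem UpperTri.unit_mul_unit (i j k : Fin n) (hij : i ≤ j) (hjk : j ≤ k) :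
    UpperTri.unit R A i j hij * UpperTri.unit R A j k hjk =
      UpperTri.unit R A i k (hij.trans hjk) := by
  refine Subtype.ext ?_
  change Matrix.single i j (1 : A) * Matrix.single j k (1 : A) = Matrix.single i k (1 : A)
  simp

end

variable {R A : Type u} [CommRing R] [Ring A] [Algebra R A] {n : ℕ}

/-- An object of the morphism category `Mor_n(A)`, i.e. a chain
`X_{n-1} → ⋯ → X_1 → X_0` of `n` modules (with indices starting at `0`). -/
structure MorObj (A : Type u) [Ring A] (n : ℕ) where
  /-- the branches -/
  X : Fin n → ModuleCat.{u} A
  /-- the maps `X_{i+1} → X_i` -/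
  φ : ∀ (i : ℕ) (hi : i + 1 < n), X ⟨i + 1, hi⟩ →ₗ[A] X ⟨i, Nat.lt_of_succ_lt hi⟩

/-- The `i`-th branch `e_{ii} Y = {y | e_{ii} y = y}` of a `T_n(A)`-module `Y`, as an
`A`-module. -/
def UpperTri.branch (Y : ModuleCat.{u} (UpperTri R A n)) (i : Fin n) :
    Submodule A ((ModuleCat.restrictScalars (UpperTri.diag R A n)).obj Y) where
  carrier := {y | UpperTri.unit R A i i le_rfl • (show Y from y) = (show Y from y)}
  add_mem' {x y} hx hy := (smul_add (UpperTri.unit R A i i le_rfl)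
    (show Y from x) (show Y from y)).trans (congrArg₂ _ hx hy)
  zero_mem' := smul_zero (A := Y) (UpperTri.unit R A i i le_rfl)
  smul_mem' a y hy := by
    change UpperTri.unit R A i i le_rfl • (UpperTri.diag R A n a • (show Y from y))
      = UpperTri.diag R A n a • (show Y from y)
    rw [← mul_smul, UpperTri.unit_mul_diag, mul_smul]
    exact congrArg (fun z : Y => UpperTri.diag R A n a • z) hy

/-- The `A`-linear map `e_{jj} Y → e_{ii} Y` given by multiplication with `e_{ij}`. -/
def UpperTri.branchMap (Y : ModuleCat.{u} (UpperTri R A n)) (i j : Fin n) (h : i ≤ j) :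
    UpperTri.branch Y j →ₗ[A] UpperTri.branch Y i where
  toFun y := ⟨UpperTri.unit R A i j h • (show Y from y.1), by
    change UpperTri.unit R A i i le_rfl • (UpperTri.unit R A i j h • (show Y from y.1)) =
      UpperTri.unit R A i j h • (show Y from y.1)
    rw [← mul_smul, UpperTri.unit_mul_unit]⟩
  map_add' x y := Subtype.ext (smul_add (UpperTri.unit R A i j h)
    (show Y from x.1) (show Y from y.1))
  map_smul' a y := Subtype.ext (by
    change UpperTri.unit R A i j h • (UpperTri.diag R A n a • (show Y from y.1))
      = UpperTri.diag R A n a • (UpperTri.unit R A i j h • (show Y from y.1))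
    rw [← mul_smul, UpperTri.unit_mul_diag, mul_smul])

/-- The object of `Mor_n(A)` with which a `T_n(A)`-module `Y` is identified: the branches are
`e_{ii} Y`, the maps are multiplication with `e_{i,i+1}`. -/
noncomputable def UpperTri.toMor (Y : ModuleCat.{u} (UpperTri R A n)) : MorObj A n where
  X i := ModuleCat.of A (UpperTri.branch Y i)
  φ i _ := UpperTri.branchMap Y _ _ (Nat.le_succ i)

variable (R A n) in
/-- The monomorphism category `S_n(A)`, as a full subcategory of the category of finitely
generated `T_n(A)`-modules: all maps in the corresponding object of `Mor_n(A)` are monic. -/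
def monoCat : ObjectProperty (ModuleCat.{u} (UpperTri R A n)) :=
  fun Y => Module.Finite (UpperTri R A n) Y ∧
    ∀ (i : ℕ) (hi : i + 1 < n), Function.Injective ((UpperTri.toMor Y).φ i hi)

/-- `M^n` as a module of column vectors over `T_n(A)`: this is the object of `Mor_n(A)` all of
whose branches are `M` and all of whose maps are the identity. -/
def Column (_R A : Type u) (n : ℕ) [CommRing _R] [Ring A] [Algebra _R A]
    (M : Type u) [AddCommGroup M] [Module A M] : Type u :=
  Fin n → M

variable (R A n) in
instance (M : Type u) [AddCommGroup M] [Module A M] : AddCommGroup (Column R A n M) :=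
  inferInstanceAs (AddCommGroup (Fin n → M))

open scoped Matrix.Module in
variable (R A n) in
/-- The matrix action `(a • x) i = ∑ j, a i j • x j`. -/
instance (M : Type u) [AddCommGroup M] [Module A M] :
    Module (UpperTri R A n) (Column R A n M) :=
  inferInstanceAs (Module (Matrix.blockTriangularSubalgebra R A (id : Fin n → Fin n)) (Fin n → M))

theorem Column.smul_apply (M : Type u) [AddCommGroup M] [Module A M] (a : UpperTri R A n)
    (x : Column R A n M) (i : Fin n) : (a • x) i = ∑ j, a.1 i j • x j :=
  rfl

variable (R A n) in
/-- `m_i(M) = (M, …, M, 0, …, 0)`: the `T_n(A)`-module of all column vectors over `M` whose entries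
at the positions `j > i` vanish (so that position `i`, with indices starting at `0`, is the last
one where `M` stands). -/
def mBranch (M : Type u) [AddCommGroup M] [Module A M] (i : Fin n) :
    Submodule (UpperTri R A n) (Column R A n M) where
  carrier := {x | ∀ j, i < j → x j = 0}
  add_mem' {x y} hx hy j hj :=
    (congrArg₂ (· + ·) (hx j hj) (hy j hj)).trans (add_zero 0)
  zero_mem' _ _ := rfl
  smul_mem' a x hx j hj := by
    rw [Column.smul_apply]
    refine Finset.sum_eq_zero fun k _ => ?_
    rcases lt_or_ge k j with hk | hk
    · rw [a.2 hk, zero_smul]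
    · rw [hx k (hj.trans_le hk), smul_zero]

variable (R A n) in
/-- `m(M)`, the direct sum of all `m_i(M)`. -/
def mModule (M : Type u) [AddCommGroup M] [Module A M] : ModuleCat.{u} (UpperTri R A n) :=
  ModuleCat.of (UpperTri R A n) (∀ i : Fin n, mBranch R A n M i)

end Monomorphism

/-! Write `M` for `D(A)`, and number positions from 0, so that `mBranch i` has entries at positions
0, ..., i and `headColumn i` at positions 0, ..., i-1. Matlis duality over `R` makes `M` a finitely
generated injective cogenerator with `End_A(M) = A^op`. The quotient `tailColumn i` of the full
column module by `headColumn i` is coinduced from the i-th branch: `T_n(A)`-maps `X → tailColumn i`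
correspond to `A`-maps `X_i → M`. Hence `0 → headColumn i → Column → tailColumn i → 0` is an
injective copresentation, and `X` lies in `⊥(headColumn i)` exactly when every map `X_i → M` extends
along the composite `X_i → X_0`. As `M` is an injective cogenerator, this says that the composite is
injective. Imposing it for all i gives the monomorphism category. The summands of `m(M)` are the
modules `headColumn i` with i > 0 and the injective module `Column`, so `S_n(A) = ⊥m(M)`
(`monoCat_eq_leftPerp_mModule`) and the injective dimension is at most 1; it is not 0, since some
finitely generated modules lie outside `S_n(A)`.

Self-orthogonality holds because `m(M)` itself lies in `S_n(A)`. Pairing triangular matrices with n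
columns over `M` gives `0 → ⊕ headColumn i → Column^n → D(T_n(A)) → 0`, the resolution required of a
cotilting module (`hasFiniteAddResolution_mModule`).

For the endomorphism ring, view `m(M)` as the upper triangular matrices over `M`. An endomorphism is
determined by what it does to row 0, and is right multiplication by a triangular matrix over `A`
(`mModule.rightMulHom_surjective`).

For uniqueness, if `C` is cotilting, a left `add C`-approximation embeds each `X` in `⊥C` into some
`C^k` with cokernel in `⊥C` (`exists_coresolution`). If `⊥C = ⊥T`, then for `X = T` this embedding
splits, so `T` is in `add C`; by symmetry `C` is in `add T`, and Fitting's lemma compares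
indecomposable summands. -/

/-! ### Matlis duality over a commutative artinian ring. -/

section MatlisDuality

variable {R : Type u} [CommRing R]

/-- The inclusion of a module into its injective envelope. -/
noncomputable def injectiveEnvelope.ι (R : Type u) [Ring R] (M : Type u) [AddCommGroup M]
    [Module R M] : M →ₗ[R] injectiveEnvelope R M :=
  (exists_isInjectiveEnvelope R M).choose_spec.choose

theorem injectiveEnvelope.isInjectiveEnvelope (R : Type u) [Ring R] (M : Type u) [AddCommGroup M]
    [Module R M] : IsInjectiveEnvelope (injectiveEnvelope.ι R M) :=
  (exists_isInjectiveEnvelope R M).choose_spec.choose_spec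

variable (R) in
/-- The injective envelope of `R / rad R`. -/
noncomputable abbrev minimalCogenerator : ModuleCat.{u} R :=
  injectiveEnvelope R (R ⧸ Ring.jacobson R)

instance : Module.Injective R (minimalCogenerator R) :=
  (injectiveEnvelope.isInjectiveEnvelope R _).injective_module

/-- A simple submodule of the injective envelope of `M` lies in `M`. -/
theorem IsInjectiveEnvelope.mem_range_of_isSimpleModule {M E S : Type u} [AddCommGroup M]
    [Module R M] [AddCommGroup E] [Module R E] [AddCommGroup S] [Module R S] [IsSimpleModule R S]
    {i : M →ₗ[R] E} (hi : IsInjectiveEnvelope i) (f : S →ₗ[R] E) (s : S) :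
    f s ∈ LinearMap.range i := by
  rcases eq_bot_or_eq_top ((LinearMap.range i).comap f) with h | h
  · have h0 : LinearMap.range f = ⊥ := by
      refine hi.essential _ ?_
      rw [Submodule.eq_bot_iff]
      rintro _ ⟨⟨s, rfl⟩, hs⟩
      have : s ∈ (LinearMap.range i).comap f := hs
      rw [h, Submodule.mem_bot] at this
      rw [this, map_zero]
    rw [LinearMap.range_eq_bot.mp h0]
    exact zero_mem _
  · have : s ∈ (LinearMap.range i).comap f := h ▸ Submodule.mem_top
    exact this

/-- An element of `R / rad R` which is killed by a maximal ideal is determined by its residue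
modulo that ideal. -/
theorem eq_zero_of_smul_eq_zero_of_mem {m : Ideal R} [m.IsMaximal] {x : R} (hxm : x ∈ m)
    (h : ∀ r ∈ m, r • (Ideal.Quotient.mk (Ring.jacobson R) x) = 0) :
    Ideal.Quotient.mk (Ring.jacobson R) x = 0 := by
  -- Taking `r = x` shows that `x * x` is in the radical, hence in every maximal ideal; these are
  -- prime.
  have h2 := h x hxm
  rw [Algebra.smul_def] at h2
  have h3 : x * x ∈ Ring.jacobson R := by
    rw [← Ideal.Quotient.eq_zero_iff_mem, map_mul]
    exact h2
  rw [Ideal.Quotient.eq_zero_iff_mem]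
  rw [Ring.jacobson_eq_sInf_isMaximal, Ideal.mem_sInf] at h3 ⊢
  intro I hI
  have hI' : I.IsMaximal := hI
  exact (hI'.isPrime.mem_or_mem (h3 hI)).elim id id

/-- With `S = R/m` generated by `s`, the value `f s` lies in `R / rad R` by essentiality, and its
residue modulo `m` determines `f`; so the Hom module embeds into the simple module `R/m`. -/
theorem length_hom_minimalCogenerator_le_one (S : Type u) [AddCommGroup S] [Module R S]
    [IsSimpleModule R S] : Module.length R (S →ₗ[R] minimalCogenerator R) ≤ 1 := by
  obtain ⟨m, hm, ⟨e⟩⟩ := isSimpleModule_iff_quot_maximal.mp ‹IsSimpleModule R S›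
  set i := injectiveEnvelope.ι R (R ⧸ Ring.jacobson R) with hi
  have hinj := (injectiveEnvelope.isInjectiveEnvelope R (R ⧸ Ring.jacobson R))
  let s : S := e.symm (Ideal.Quotient.mk m 1)
  have hs : ∀ r ∈ m, r • s = 0 := fun r hr => by
    rw [← map_smul, Algebra.smul_def]
    simp [Ideal.Quotient.eq_zero_iff_mem.mpr hr]
  have hgen : ∀ t : S, ∃ r : R, t = r • s := fun t => by
    obtain ⟨r, hr⟩ := Ideal.Quotient.mk_surjective (e t)
    refine ⟨r, e.injective ?_⟩
    rw [map_smul, LinearEquiv.apply_symm_apply, ← hr, Algebra.smul_def]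
    simp
  let ei := LinearEquiv.ofInjective i hinj.injective
  have hJle : Ring.jacobson R ≤ m := by
    rw [Ring.jacobson_eq_sInf_isMaximal]
    exact sInf_le hm
  let F : (S →ₗ[R] minimalCogenerator R) →ₗ[R] (R ⧸ m) :=
    (Submodule.mapQ _ _ LinearMap.id hJle) ∘ₗ ei.symm.toLinearMap ∘ₗ
      ((LinearMap.applyₗ s).codRestrict (LinearMap.range i)
        fun f => hinj.mem_range_of_isSimpleModule f s)
  have hF : Function.Injective F := by
    rw [← LinearMap.ker_eq_bot, LinearMap.ker_eq_bot']
    intro f hf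
    obtain ⟨x', hx'⟩ := hinj.mem_range_of_isSimpleModule f s
    obtain ⟨x, rfl⟩ := Ideal.Quotient.mk_surjective x'
    have h1 : F f = Ideal.Quotient.mk m x := by
      change Submodule.mapQ _ _ LinearMap.id hJle (ei.symm ⟨f s, _⟩) = _
      have : ei.symm ⟨f s, hinj.mem_range_of_isSimpleModule f s⟩ =
          Ideal.Quotient.mk (Ring.jacobson R) x := by
        rw [LinearEquiv.symm_apply_eq]
        exact Subtype.ext hx'.symm
      rw [this]
      rfl
    have h2 : x ∈ m := Ideal.Quotient.eq_zero_iff_mem.mp (h1 ▸ hf)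
    have h3 := eq_zero_of_smul_eq_zero_of_mem h2 fun r hr => hinj.injective (by
      rw [map_smul, hx', ← map_smul, hs r hr, map_zero, map_zero])
    rw [h3, map_zero] at hx'
    ext t
    obtain ⟨r, rfl⟩ := hgen t
    rw [map_smul, ← hx', smul_zero, LinearMap.zero_apply]
  have : IsSimpleModule R (R ⧸ m) := isSimpleModule_iff_isCoatom.mpr hm.out
  exact (Module.length_le_of_injective F hF).trans (Module.length_eq_one R _).le

/-- Dualizing with the minimal cogenerator does not increase the length. -/
theorem length_hom_minimalCogenerator_le {M : Type u} [AddCommGroup M] [Module R M]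
    (h : IsFiniteLength R M) :
    Module.length R (M →ₗ[R] minimalCogenerator R) ≤ Module.length R M := by
  induction h with
  | of_subsingleton => simp
  | @of_simple_quotient M _ _ N _ _ ih =>
    rw [Module.length_eq_add_of_exact N.subtype N.mkQ N.injective_subtype N.mkQ_surjective
      (LinearMap.exact_subtype_mkQ N)]
    let f : ((M ⧸ N) →ₗ[R] minimalCogenerator R) →ₗ[R] (M →ₗ[R] minimalCogenerator R) :=
      LinearMap.lcomp R _ N.mkQ
    let g : (M →ₗ[R] minimalCogenerator R) →ₗ[R] (N →ₗ[R] minimalCogenerator R) :=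
      LinearMap.lcomp R _ N.subtype
    have hf : Function.Injective f := fun a b hab =>
      LinearMap.ext fun x => by
        obtain ⟨x, rfl⟩ := N.mkQ_surjective x
        exact LinearMap.congr_fun hab x
    have hg : Function.Surjective g := fun a =>
      Module.Injective.extension_property R _ _ _ N.subtype N.injective_subtype a
    have hfg : Function.Exact f g := by
      intro a
      constructor
      · intro ha
        refine ⟨N.liftQ a fun x hx => LinearMap.congr_fun ha ⟨x, hx⟩, ?_⟩
        ext x
        rfl
      · rintro ⟨b, rfl⟩
        ext x
        change b (N.mkQ x) = 0
        rw [show N.mkQ (x : M) = 0 from (Submodule.Quotient.mk_eq_zero N).mpr x.2, map_zero]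
    rw [Module.length_eq_add_of_exact f g hf hg hfg, add_comm]
    exact add_le_add ih
      ((length_hom_minimalCogenerator_le_one _).trans (Module.length_eq_one R _).ge)

variable [IsArtinianRing R]

theorem IsArtinianRing.isFiniteLength (M : Type u) [AddCommGroup M] [Module R M]
    [Module.Finite R M] : IsFiniteLength R M :=
  isFiniteLength_iff_isNoetherian_isArtinian.mpr ⟨inferInstance, inferInstance⟩

theorem finite_hom_minimalCogenerator (M : Type u) [AddCommGroup M] [Module R M]
    [Module.Finite R M] : Module.Finite R (M →ₗ[R] minimalCogenerator R) := by
  have h := IsArtinianRing.isFiniteLength (R := R) M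
  have h2 : IsFiniteLength R (M →ₗ[R] minimalCogenerator R) := by
    rw [← Module.length_ne_top_iff] at h ⊢
    exact ((length_hom_minimalCogenerator_le (Module.length_ne_top_iff.mp h)).trans_lt
      (lt_top_iff_ne_top.mpr h)).ne
  have := (isFiniteLength_iff_isNoetherian_isArtinian.mp h2).1
  infer_instance

/-- The minimal cogenerator separates points. -/
theorem exists_hom_minimalCogenerator_ne_zero {M : Type u} [AddCommGroup M] [Module R M] {x : M}
    (hx : x ≠ 0) : ∃ f : M →ₗ[R] minimalCogenerator R, f x ≠ 0 := by
  have hann : Ideal.torsionOf R M x ≠ ⊤ := by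
    rw [Ne, Ideal.torsionOf_eq_top_iff]
    exact hx
  obtain ⟨m, hm, hle⟩ := Ideal.exists_le_maximal _ hann
  have hJle : Ring.jacobson R ≤ m := by
    rw [Ring.jacobson_eq_sInf_isMaximal]
    exact sInf_le hm
  -- By semisimplicity `R / rad R → R/m` splits, so `R/m` embeds into the cogenerator. The wanted
  -- functional extends `R x → R/m → R / rad R → J`.
  have : IsSemisimpleModule R (R ⧸ Ring.jacobson R) :=
    (IsArtinian.isSemisimpleModule_iff_jacobson R _).mpr (Module.jacobson_quotient_jacobson R R)
  let p : (R ⧸ Ring.jacobson R) →ₗ[R] (R ⧸ m) := Submodule.mapQ _ _ LinearMap.id hJle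
  have hp : Function.Surjective p := fun y => by
    obtain ⟨y, rfl⟩ := Ideal.Quotient.mk_surjective y
    exact ⟨Ideal.Quotient.mk _ y, rfl⟩
  obtain ⟨q, hq⟩ := IsSemisimpleModule.lifting_property p hp LinearMap.id
  have hinj := injectiveEnvelope.isInjectiveEnvelope R (R ⧸ Ring.jacobson R)
  let u : (R ∙ x) →ₗ[R] (R ⧸ m) :=
    (Submodule.mapQ _ _ LinearMap.id hle) ∘ₗ (Ideal.quotTorsionOfEquivSpanSingleton R M x).symm
  obtain ⟨f, hf⟩ := Module.Injective.extension_property R (minimalCogenerator R) _ _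
    (R ∙ x).subtype (R ∙ x).injective_subtype (injectiveEnvelope.ι R _ ∘ₗ q ∘ₗ u)
  refine ⟨f, fun h0 => ?_⟩
  have hux : u ⟨x, Submodule.mem_span_singleton_self x⟩ = Ideal.Quotient.mk m 1 := by
    have : (Ideal.quotTorsionOfEquivSpanSingleton R M x).symm
        ⟨x, Submodule.mem_span_singleton_self x⟩ = Ideal.Quotient.mk _ 1 := by
      rw [LinearEquiv.symm_apply_eq]
      refine Subtype.ext ?_
      change x = _
      exact (one_smul R x).symm
    change Submodule.mapQ _ _ LinearMap.id hle (LinearEquiv.symm _ _) = _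
    rw [this]
    rfl
  have h1 := LinearMap.congr_fun hf ⟨x, Submodule.mem_span_singleton_self x⟩
  change f x = injectiveEnvelope.ι R _ (q (u _)) at h1
  rw [h0, hux, eq_comm, map_eq_zero_iff _ hinj.injective] at h1
  have h2 := LinearMap.congr_fun hq (Ideal.Quotient.mk m 1)
  change p (q _) = _ at h2
  rw [h1, map_zero] at h2
  exact hm.ne_top ((Ideal.eq_top_iff_one _).mpr (Ideal.Quotient.eq_zero_iff_mem.mp h2.symm))

/-- Modules of finite length over a commutative artinian ring are reflexive with respect to the
minimal cogenerator. -/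
theorem exists_eval_eq_of_hom_minimalCogenerator {M : Type u} [AddCommGroup M] [Module R M]
    [Module.Finite R M] (φ : (M →ₗ[R] minimalCogenerator R) →ₗ[R] minimalCogenerator R) :
    ∃ x : M, ∀ f, φ f = f x := by
  let ev : M →ₗ[R] ((M →ₗ[R] minimalCogenerator R) →ₗ[R] minimalCogenerator R) :=
    LinearMap.applyₗ
  have hinj : Function.Injective ev := by
    rw [← LinearMap.ker_eq_bot, LinearMap.ker_eq_bot']
    intro x hx
    by_contra h
    obtain ⟨f, hf⟩ := exists_hom_minimalCogenerator_ne_zero (R := R) h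
    exact hf (LinearMap.congr_fun hx f)
  have := finite_hom_minimalCogenerator (R := R) M
  -- The double dual is no longer than `M`, so the injective evaluation map has a cokernel of length
  -- zero.
  have hle := (length_hom_minimalCogenerator_le
    (IsArtinianRing.isFiniteLength (R := R) (M →ₗ[R] minimalCogenerator R))).trans
    (length_hom_minimalCogenerator_le (IsArtinianRing.isFiniteLength (R := R) M))
  rw [Module.length_eq_add_of_exact ev (LinearMap.range ev).mkQ hinj
    (Submodule.mkQ_surjective _) (LinearMap.exact_map_mkQ_range ev)] at hle
  have hfin : Module.length R M ≠ ⊤ := Module.length_ne_top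
  have h0 : Module.length R (_ ⧸ LinearMap.range ev) = 0 := by
    have h := hle.trans (add_zero (Module.length R M)).ge
    rw [ENat.add_le_add_iff_left hfin] at h
    exact le_antisymm h zero_le
  rw [Module.length_eq_zero_iff, Submodule.Quotient.subsingleton_iff] at h0
  obtain ⟨x, hx⟩ : φ ∈ LinearMap.range ev := h0 ▸ Submodule.mem_top
  exact ⟨x, fun f => by rw [← hx]; rfl⟩

end MatlisDuality

/-! ### `D(Λ)` as an injective cogenerator, and its endomorphisms. -/

section DualRegular

variable {R Λ : Type u} [CommRing R] [Ring Λ] [Algebra R Λ]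

/-- An element of `D(Λ)` as a linear map. -/
noncomputable def DualRegular.toHom : DualRegular R Λ ≃+ (Λ →ₗ[R] minimalCogenerator R) :=
  AddEquiv.refl _

theorem DualRegular.toHom_smul (a : Λ) (f : DualRegular R Λ) (x : Λ) :
    (a • f).toHom x = f.toHom (x * a) :=
  rfl

theorem DualRegular.toHom_algebraMap_smul (r : R) (f : DualRegular R Λ) :
    (algebraMap R Λ r • f).toHom = r • f.toHom := by
  ext x
  rw [DualRegular.toHom_smul, ← Algebra.commutes, ← Algebra.smul_def, map_smul]
  rfl

@[ext]
theorem DualRegular.ext {f g : DualRegular R Λ} (h : ∀ x, f.toHom x = g.toHom x) : f = g :=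
  DualRegular.toHom.injective (LinearMap.ext h)

/-- A linear functional on the underlying `R`-module corresponds to a `Λ`-linear map to
`D(Λ)`. -/
theorem DualRegular.exists_hom_of_functional {M : Type u} [AddCommGroup M] [Module R M]
    [Module Λ M] [IsScalarTower R Λ M] (φ : M →ₗ[R] minimalCogenerator R) :
    ∃ g : M →ₗ[Λ] DualRegular R Λ, ∀ x a, (g x).toHom a = φ (a • x) := by
  refine ⟨{ toFun := fun x => DualRegular.toHom.symm
              (φ ∘ₗ (LinearMap.toSpanSingleton Λ M x).restrictScalars R)
            map_add' := fun x y => ?_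
            map_smul' := fun a x => ?_ }, fun x a => rfl⟩
  · ext b
    change φ (b • (x + y)) = φ (b • x) + φ (b • y)
    rw [smul_add, map_add]
  · ext b
    change φ (b • a • x) = φ ((b * a) • x)
    rw [mul_smul]

/-- By the adjunction `Hom_Λ(X, D(Λ)) = Hom_R(X, J)`, evaluating at `1`, extension problems reduce
to the injectivity of `J` over `R`. -/
instance DualRegular.injective : Module.Injective Λ (DualRegular R Λ) where
  out X Y _ _ _ _ f hf g := by
    let := Module.compHom X (algebraMap R Λ)
    let := Module.compHom Y (algebraMap R Λ)
    have : IsScalarTower R Λ X := IsScalarTower.of_algebraMap_smul fun _ _ => rfl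
    have : IsScalarTower R Λ Y := IsScalarTower.of_algebraMap_smul fun _ _ => rfl
    let φ : X →ₗ[R] minimalCogenerator R :=
      { toFun := fun x => (g x).toHom 1
        map_add' := fun x y => by rw [map_add, map_add]; rfl
        map_smul' := fun r x => by
          rw [algebra_compatible_smul Λ, map_smul, DualRegular.toHom_algebraMap_smul]; rfl }
    obtain ⟨ψ, hψ⟩ := Module.Injective.extension_property R (minimalCogenerator R) _ _
      (f.restrictScalars R) hf φ
    obtain ⟨h, hh⟩ := DualRegular.exists_hom_of_functional (Λ := Λ) ψ
    refine ⟨h, fun x => DualRegular.ext fun a => ?_⟩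
    rw [hh, ← map_smul]
    have := LinearMap.congr_fun hψ (a • x)
    change ψ (f (a • x)) = (g (a • x)).toHom 1 at this
    rw [this, map_smul, DualRegular.toHom_smul, one_mul]

/-- `D(Λ)` separates points. -/
theorem DualRegular.exists_hom_ne_zero [IsArtinianRing R] {M : Type u} [AddCommGroup M]
    [Module Λ M] {x : M} (hx : x ≠ 0) : ∃ f : M →ₗ[Λ] DualRegular R Λ, f x ≠ 0 := by
  let := Module.compHom M (algebraMap R Λ)
  have : IsScalarTower R Λ M := IsScalarTower.of_algebraMap_smul fun _ _ => rfl
  obtain ⟨φ, hφ⟩ := exists_hom_minimalCogenerator_ne_zero (R := R) hx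
  obtain ⟨g, hg⟩ := DualRegular.exists_hom_of_functional (Λ := Λ) φ
  refine ⟨g, fun h => hφ ?_⟩
  rw [← one_smul Λ x, ← hg, h]
  rfl

/-- Reflexivity of `Λ`. The `R`-linearity is phrased through `algebraMap`, because `DualRegular`
only carries its `Λ`-action. -/
theorem DualRegular.exists_functional_eq [IsArtinianRing R] [Module.Finite R Λ]
    (φ : DualRegular R Λ →+ minimalCogenerator R)
    (hφ : ∀ (r : R) f, φ (algebraMap R Λ r • f) = r • φ f) :
    ∃ a : Λ, ∀ f, φ f = f.toHom a := by
  obtain ⟨a, ha⟩ := exists_eval_eq_of_hom_minimalCogenerator (R := R) (M := Λ)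
    { toFun := fun f => φ (DualRegular.toHom.symm f)
      map_add' := fun f g => by rw [map_add, map_add]
      map_smul' := fun r f => by
        rw [RingHom.id_apply, ← hφ]
        refine congrArg φ (DualRegular.toHom.injective ?_)
        rw [DualRegular.toHom_algebraMap_smul, AddEquiv.apply_symm_apply,
          AddEquiv.apply_symm_apply] }
  exact ⟨a, fun f => ha f.toHom⟩

/-- The right action of `Λ` on `D(Λ)`: `(f a) x = f (a x)`. -/
noncomputable def DualRegular.rightMul (a : Λ) : DualRegular R Λ →ₗ[Λ] DualRegular R Λ where
  toFun f := DualRegular.toHom.symm (f.toHom ∘ₗ LinearMap.mulLeft R a)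
  map_add' _ _ := rfl
  map_smul' b f := DualRegular.ext fun x => congrArg f.toHom (mul_assoc a x b)

/-- Every endomorphism of `D(Λ)` is a right multiplication. -/
theorem DualRegular.exists_rightMul_eq [IsArtinianRing R] [Module.Finite R Λ]
    (θ : DualRegular R Λ →ₗ[Λ] DualRegular R Λ) :
    ∃ a : Λ, θ = DualRegular.rightMul a := by
  -- The functional `f ↦ θ(f)(1)` is evaluation at some `a`; applied to `x • f` it yields `θ(f)(x) =
  -- f(a x)`.
  obtain ⟨a, ha⟩ := DualRegular.exists_functional_eq (R := R) (Λ := Λ)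
    { toFun := fun f => (θ f).toHom 1
      map_zero' := by rw [map_zero]; rfl
      map_add' := fun f g => by rw [map_add]; rfl }
    (fun r f => by
      change (θ (algebraMap R Λ r • f)).toHom 1 = r • (θ f).toHom 1
      rw [map_smul, DualRegular.toHom_algebraMap_smul]
      rfl)
  refine ⟨a, LinearMap.ext fun f => DualRegular.ext fun x => ?_⟩
  have := ha (x • f)
  change (θ (x • f)).toHom 1 = _ at this
  rwa [map_smul, DualRegular.toHom_smul, one_mul, DualRegular.toHom_smul] at this

theorem DualRegular.eq_zero_of_rightMul_eq_zero [IsArtinianRing R] {a : Λ}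
    (h : ∀ f : DualRegular R Λ, DualRegular.rightMul a f = 0) : a = 0 := by
  by_contra ha
  obtain ⟨f, hf⟩ := exists_hom_minimalCogenerator_ne_zero (R := R) ha
  refine hf ?_
  have := congrArg (fun g : DualRegular R Λ => g.toHom 1) (h (DualRegular.toHom.symm f))
  change f (a * 1) = 0 at this
  rwa [mul_one] at this

instance DualRegular.finite [IsArtinianRing R] [Module.Finite R Λ] :
    Module.Finite Λ (DualRegular R Λ) := by
  let : Module R (DualRegular R Λ) := Module.compHom _ (algebraMap R Λ)
  have : IsScalarTower R Λ (DualRegular R Λ) := IsScalarTower.of_algebraMap_smul fun _ _ => rfl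
  have := finite_hom_minimalCogenerator (R := R) Λ
  let e : (Λ →ₗ[R] minimalCogenerator R) ≃ₗ[R] DualRegular R Λ :=
    { DualRegular.toHom.symm with
      map_smul' := fun r f => DualRegular.toHom.injective
        (DualRegular.toHom_algebraMap_smul r (DualRegular.toHom.symm f)).symm }
  have := Module.Finite.equiv e
  exact Module.Finite.of_restrictScalars_finite R Λ _

end DualRegular

/-! ### Retracts, `add M`, and Fitting's lemma. -/

section AddClosure

open CategoryTheory

variable {Λ : Type u} [Ring Λ]

theorem isDirectSummand_iff {N M : ModuleCat.{u} Λ} :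
    IsDirectSummand N M ↔ ∃ (f : N →ₗ[Λ] M) (g : M →ₗ[Λ] N), g ∘ₗ f = LinearMap.id := by
  constructor
  · rintro ⟨N', ⟨e⟩⟩
    refine ⟨e.toLinearMap ∘ₗ LinearMap.inl Λ N N', LinearMap.fst Λ N N' ∘ₗ e.symm.toLinearMap,
      LinearMap.ext fun x => ?_⟩
    simp
  · rintro ⟨f, g, h⟩
    have h' : ∀ x, g (f x) = x := LinearMap.congr_fun h
    refine ⟨ModuleCat.of Λ (LinearMap.ker g),
      ⟨LinearEquiv.ofBijective (f.coprod (LinearMap.ker g).subtype) ⟨?_, fun y => ?_⟩⟩⟩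
    · rw [← LinearMap.ker_eq_bot, LinearMap.ker_eq_bot']
      rintro ⟨x, z, hz⟩ hxz
      change f x + z = 0 at hxz
      have hx : x = 0 := by
        have := congrArg g hxz
        rwa [map_add, h', LinearMap.mem_ker.mp hz, add_zero, map_zero] at this
      subst hx
      rw [map_zero, zero_add] at hxz
      subst hxz
      rfl
    · refine ⟨⟨g y, y - f (g y), ?_⟩, ?_⟩
      · rw [LinearMap.mem_ker, map_sub, h', sub_self]
      · change f (g y) + (y - f (g y)) = y
        abel

/-- This splitting of the identity of `N` into endomorphisms factoring through `M` is the form that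
serves both the Ext computations and the local-ring argument. -/
theorem memAdd_iff {N M : ModuleCat.{u} Λ} :
    MemAdd N M ↔ ∃ (k : ℕ) (a : Fin k → (N →ₗ[Λ] M)) (b : Fin k → (M →ₗ[Λ] N)),
      ∑ j, b j ∘ₗ a j = LinearMap.id := by
  constructor
  · rintro ⟨k, hk⟩
    obtain ⟨f, g, h⟩ := isDirectSummand_iff.mp hk
    refine ⟨k, fun j => LinearMap.proj j ∘ₗ f, fun j => g ∘ₗ LinearMap.single Λ (fun _ => M) j,
      LinearMap.ext fun x => ?_⟩
    rw [LinearMap.sum_apply]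
    change ∑ j, g (Pi.single j (f x j)) = x
    rw [← map_sum, Finset.univ_sum_single]
    exact LinearMap.congr_fun h x
  · rintro ⟨k, a, b, h⟩
    refine ⟨k, isDirectSummand_iff.mpr ⟨LinearMap.pi a,
      ∑ j, b j ∘ₗ LinearMap.proj j, LinearMap.ext fun x => ?_⟩⟩
    have := LinearMap.congr_fun h x
    rw [LinearMap.sum_apply] at this
    rw [LinearMap.comp_apply, LinearMap.sum_apply]
    exact this

theorem memAdd_of_retract {N M : ModuleCat.{u} Λ} {k : ℕ} (f : N →ₗ[Λ] (Fin k → M))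
    (g : (Fin k → M) →ₗ[Λ] N) (h : ∀ x, g (f x) = x) : MemAdd N M :=
  ⟨k, isDirectSummand_iff.mpr ⟨f, g, LinearMap.ext h⟩⟩

theorem memAdd_of_subsingleton (N M : ModuleCat.{u} Λ) [Subsingleton N] : MemAdd N M :=
  memAdd_iff.mpr ⟨0, Fin.elim0, Fin.elim0, LinearMap.ext fun _ => Subsingleton.elim _ _⟩

theorem IsDirectSummand.memAdd {L N M : ModuleCat.{u} Λ} (h : IsDirectSummand L N)
    (hN : MemAdd N M) : MemAdd L M := by
  obtain ⟨f, g, hfg⟩ := isDirectSummand_iff.mp h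
  obtain ⟨k, a, b, hab⟩ := memAdd_iff.mp hN
  refine memAdd_iff.mpr ⟨k, fun j => a j ∘ₗ f, fun j => g ∘ₗ b j, LinearMap.ext fun x => ?_⟩
  have := LinearMap.congr_fun hab (f x)
  rw [LinearMap.sum_apply] at this ⊢
  change ∑ j, g (b j (a j (f x))) = x
  rw [← map_sum]
  exact (congrArg g this).trans (LinearMap.congr_fun hfg x)

/-- Fitting's lemma: an endomorphism of an indecomposable module of finite length is nilpotent
or invertible. -/
theorem IsIndecomposableModule.isUnit_or_isNilpotent {N : ModuleCat.{u} Λ}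
    (hN : IsIndecomposableModule N) [IsNoetherian Λ N] [IsArtinian Λ N] (u : Module.End Λ N) :
    IsUnit u ∨ IsNilpotent u := by
  obtain ⟨k, hk⟩ := Filter.eventually_atTop.mp u.eventually_isCompl_ker_pow_range_pow
  -- The exponent must be positive, so that the kernel of `u` lies in the kernel of the power and
  -- the range of the power in the range of `u`.
  have hk1 := hk (k + 1) (Nat.le_succ k)
  rcases hN.2 _ _ hk1 with h | h
  · left
    have hr : LinearMap.range (u ^ (k + 1)) = ⊤ := by
      have := hk1.sup_eq_top
      rwa [h, bot_sup_eq] at this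
    rw [Module.End.isUnit_iff]
    constructor
    · rw [← LinearMap.ker_eq_bot, eq_bot_iff, ← h]
      intro x hx
      rw [LinearMap.mem_ker] at hx ⊢
      rw [pow_succ, Module.End.mul_apply, hx, map_zero]
    · intro y
      obtain ⟨x, hx⟩ : y ∈ LinearMap.range (u ^ (k + 1)) := hr ▸ Submodule.mem_top
      rw [pow_succ', Module.End.mul_apply] at hx
      exact ⟨_, hx⟩
  · exact Or.inr ⟨k + 1, LinearMap.range_eq_bot.mp h⟩

/-- Locality of the endomorphism ring: with `w` the whole sum, if `w⁻¹ * u j` is nilpotent, then `1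
- w⁻¹ * u j` is invertible, and so is the sum of the other terms. -/
theorem IsIndecomposableModule.exists_isUnit_of_isUnit_sum {N : ModuleCat.{u} Λ}
    (hN : IsIndecomposableModule N) [IsNoetherian Λ N] [IsArtinian Λ N] {ι : Type*}
    (s : Finset ι) (u : ι → Module.End Λ N) (h : IsUnit (∑ j ∈ s, u j)) :
    ∃ j ∈ s, IsUnit (u j) := by
  classical
  induction s using Finset.induction_on with
  | empty =>
    have := hN.1
    rw [Finset.sum_empty] at h
    exact absurd h not_isUnit_zero
  | insert j s hj ih =>
    rw [Finset.sum_insert hj] at h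
    obtain ⟨w, hw⟩ := h
    have hsum : ↑w⁻¹ * u j + ↑w⁻¹ * (∑ i ∈ s, u i) = 1 := by
      rw [← mul_add, ← hw, Units.inv_mul]
    rcases hN.isUnit_or_isNilpotent (↑w⁻¹ * u j) with h1 | h1
    · exact ⟨j, Finset.mem_insert_self _ _, (Units.isUnit_units_mul _ _).mp h1⟩
    · have h2 := h1.isUnit_one_sub
      rw [← eq_sub_iff_add_eq'.mpr hsum, Units.isUnit_units_mul] at h2
      obtain ⟨i, hi, hu⟩ := ih h2
      exact ⟨i, Finset.mem_insert_of_mem hi, hu⟩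

/-- An indecomposable module of finite length in `add M` is a direct summand of `M`. -/
theorem IsIndecomposableModule.isDirectSummand_of_memAdd {N M : ModuleCat.{u} Λ}
    (hN : IsIndecomposableModule N) [IsNoetherian Λ N] [IsArtinian Λ N] (h : MemAdd N M) :
    IsDirectSummand N M := by
  obtain ⟨k, a, b, hab⟩ := memAdd_iff.mp h
  obtain ⟨j, -, w, hw⟩ := hN.exists_isUnit_of_isUnit_sum Finset.univ
    (fun j => (b j ∘ₗ a j : Module.End Λ N)) (by rw [hab]; exact isUnit_one)
  refine isDirectSummand_iff.mpr ⟨a j, (↑w⁻¹ : Module.End Λ N) ∘ₗ b j, ?_⟩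
  have : (↑w⁻¹ : Module.End Λ N) * (b j ∘ₗ a j) = 1 := by rw [← hw, Units.inv_mul]
  exact this

end AddClosure

/-! ### Ext vanishing along retracts and short exact sequences. -/

section ExtVanishing

open CategoryTheory Abelian

variable {Λ : Type u} [Ring Λ]

theorem sum_ofHom_comp_eq_id {ι : Type*} [Fintype ι] {N : ModuleCat.{u} Λ}
    {T : ι → ModuleCat.{u} Λ} {a : ∀ j, N →ₗ[Λ] T j} {b : ∀ j, T j →ₗ[Λ] N}
    (h : ∀ x, ∑ j, b j (a j x) = x) :
    ∑ j, ModuleCat.ofHom (a j) ≫ ModuleCat.ofHom (b j) = 𝟙 N := by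
  ext x
  rw [ModuleCat.hom_sum, LinearMap.sum_apply]
  exact h x

/-- Composing a class with the decomposed identity of `N` writes it as a sum of classes that factor
through the groups `Ext X (T j) n`. -/
theorem subsingleton_ext_of_sum_eq {ι : Type*} [Fintype ι] {X N : ModuleCat.{u} Λ}
    {T : ι → ModuleCat.{u} Λ} (a : ∀ j, N →ₗ[Λ] T j) (b : ∀ j, T j →ₗ[Λ] N)
    (h : ∀ x, ∑ j, b j (a j x) = x) {n : ℕ} (hT : ∀ j, Subsingleton (Ext X (T j) n)) :
    Subsingleton (Ext X N n) := by
  refine subsingleton_of_forall_eq 0 fun x => ?_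
  rw [← Ext.comp_mk₀_id x, ← sum_ofHom_comp_eq_id h, Ext.mk₀_sum, Ext.comp_sum]
  refine Finset.sum_eq_zero fun j _ => ?_
  rw [← Ext.mk₀_comp_mk₀, ← Ext.comp_assoc_of_second_deg_zero,
    (hT j).elim (x.comp (Ext.mk₀ (ModuleCat.ofHom (a j))) (add_zero n)) 0, Ext.zero_comp]

theorem subsingleton_ext_of_sum_eq' {ι : Type*} [Fintype ι] {X N : ModuleCat.{u} Λ}
    {T : ι → ModuleCat.{u} Λ} (a : ∀ j, N →ₗ[Λ] T j) (b : ∀ j, T j →ₗ[Λ] N)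
    (h : ∀ x, ∑ j, b j (a j x) = x) {n : ℕ} (hT : ∀ j, Subsingleton (Ext (T j) X n)) :
    Subsingleton (Ext N X n) := by
  refine subsingleton_of_forall_eq 0 fun x => ?_
  rw [← Ext.mk₀_id_comp x, ← sum_ofHom_comp_eq_id h, Ext.mk₀_sum, Ext.sum_comp]
  refine Finset.sum_eq_zero fun j _ => ?_
  rw [← Ext.mk₀_comp_mk₀, Ext.comp_assoc_of_second_deg_zero,
    (hT j).elim ((Ext.mk₀ (ModuleCat.ofHom (b j))).comp x (zero_add n)) 0, Ext.comp_zero]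

theorem subsingleton_ext_pi {ι : Type} [Fintype ι] {X : ModuleCat.{u} Λ} (T : ι → Type u)
    [∀ j, AddCommGroup (T j)] [∀ j, Module Λ (T j)] {n : ℕ}
    (hT : ∀ j, Subsingleton (Ext X (ModuleCat.of Λ (T j)) n)) :
    Subsingleton (Ext X (ModuleCat.of Λ (∀ j, T j)) n) := by
  classical
  refine subsingleton_ext_of_sum_eq (T := fun j => ModuleCat.of Λ (T j))
    (fun j => LinearMap.proj j) (fun j => LinearMap.single Λ T j) (fun x => ?_) hT
  exact Finset.univ_sum_single x

theorem subsingleton_ext_of_subsingleton_ext_pi {ι : Type} [Fintype ι] {X : ModuleCat.{u} Λ}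
    (T : ι → Type u) [∀ j, AddCommGroup (T j)] [∀ j, Module Λ (T j)] {n : ℕ}
    (hT : Subsingleton (Ext X (ModuleCat.of Λ (∀ j, T j)) n)) (j : ι) :
    Subsingleton (Ext X (ModuleCat.of Λ (T j)) n) := by
  classical
  refine subsingleton_ext_of_sum_eq (ι := Unit) (T := fun _ => ModuleCat.of Λ (∀ j, T j))
    (fun _ => LinearMap.single Λ T j) (fun _ => LinearMap.proj j) (fun x => ?_) (fun _ => hT)
  rw [Fintype.sum_unique]
  exact Pi.single_eq_same j x

theorem MemAdd.subsingleton_ext {X N M : ModuleCat.{u} Λ} (h : MemAdd N M) {n : ℕ}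
    (hM : Subsingleton (Ext X M n)) : Subsingleton (Ext X N n) := by
  obtain ⟨k, a, b, hab⟩ := memAdd_iff.mp h
  refine subsingleton_ext_of_sum_eq (T := fun _ => M) a b (fun x => ?_) fun _ => hM
  have := LinearMap.congr_fun hab x
  rwa [LinearMap.sum_apply] at this

theorem MemAdd.subsingleton_ext' {X N M : ModuleCat.{u} Λ} (h : MemAdd N M) {n : ℕ}
    (hM : Subsingleton (Ext M X n)) : Subsingleton (Ext N X n) := by
  obtain ⟨k, a, b, hab⟩ := memAdd_iff.mp h
  refine subsingleton_ext_of_sum_eq' (T := fun _ => M) a b (fun x => ?_) fun _ => hM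
  have := LinearMap.congr_fun hab x
  rwa [LinearMap.sum_apply] at this

theorem subsingleton_ext_of_injective {X : ModuleCat.{u} Λ} (I : Type u) [AddCommGroup I]
    [Module Λ I] [Module.Injective Λ I] (n : ℕ) :
    Subsingleton (Ext X (ModuleCat.of Λ I) (n + 1)) := by
  have := Module.injective_object_of_injective_module Λ I
  exact subsingleton_of_forall_eq 0 fun x => x.eq_zero_of_injective

variable {K I Q : Type u} [AddCommGroup K] [Module Λ K] [AddCommGroup I] [Module Λ I]
  [AddCommGroup Q] [Module Λ Q] {f : K →ₗ[Λ] I} {g : I →ₗ[Λ] Q}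

theorem moduleCat_shortExact_mk (hf : Function.Injective f) (hg : Function.Surjective g)
    (hfg : Function.Exact f g) :
    (ShortComplex.mk (ModuleCat.ofHom f) (ModuleCat.ofHom g)
      (by ext x; exact hfg.apply_apply_eq_zero x)).ShortExact :=
  ModuleCat.shortComplex_shortExact _ hfg hf hg

theorem exists_lift_of_subsingleton_ext_one (hf : Function.Injective f)
    (hg : Function.Surjective g) (hfg : Function.Exact f g) {X : ModuleCat.{u} Λ}
    (h : Subsingleton (Ext X (ModuleCat.of Λ K) 1)) (p : X →ₗ[Λ] Q) :
    ∃ q : X →ₗ[Λ] I, g ∘ₗ q = p := by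
  obtain ⟨y, hy⟩ := Ext.covariant_sequence_exact₃ X (moduleCat_shortExact_mk hf hg hfg)
    (Ext.mk₀ (ModuleCat.ofHom p)) (zero_add 1) (h.elim _ _)
  obtain ⟨q, rfl⟩ := Ext.homEquiv₀.symm.surjective y
  have h2 := Ext.homEquiv₀.symm.injective
    ((Ext.mk₀_comp_mk₀ q (ModuleCat.ofHom g)).symm.trans hy)
  exact ⟨q.hom, congrArg ModuleCat.Hom.hom h2⟩

theorem exists_extension_of_subsingleton_ext_one (hf : Function.Injective f)
    (hg : Function.Surjective g) (hfg : Function.Exact f g) {Y : ModuleCat.{u} Λ}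
    (h : Subsingleton (Ext (ModuleCat.of Λ Q) Y 1)) (p : K →ₗ[Λ] Y) :
    ∃ q : I →ₗ[Λ] Y, q ∘ₗ f = p := by
  obtain ⟨y, hy⟩ := Ext.contravariant_sequence_exact₁ (moduleCat_shortExact_mk hf hg hfg) Y
    (Ext.mk₀ (ModuleCat.ofHom p)) (add_zero 1) (h.elim _ _)
  obtain ⟨q, rfl⟩ := Ext.homEquiv₀.symm.surjective y
  have h2 := Ext.homEquiv₀.symm.injective
    ((Ext.mk₀_comp_mk₀ (ModuleCat.ofHom f) q).symm.trans hy)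
  exact ⟨q.hom, congrArg ModuleCat.Hom.hom h2⟩

theorem subsingleton_ext_right (hf : Function.Injective f)
    (hg : Function.Surjective g) (hfg : Function.Exact f g) {X : ModuleCat.{u} Λ} {n : ℕ}
    (hI : Subsingleton (Ext X (ModuleCat.of Λ I) n))
    (hK : Subsingleton (Ext X (ModuleCat.of Λ K) (n + 1))) :
    Subsingleton (Ext X (ModuleCat.of Λ Q) n) := by
  refine subsingleton_of_forall_eq 0 fun x => ?_
  obtain ⟨y, rfl⟩ := Ext.covariant_sequence_exact₃ X (moduleCat_shortExact_mk hf hg hfg)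
    x rfl (hK.elim _ _)
  rw [hI.elim y 0, Ext.zero_comp]

theorem subsingleton_ext_left (hf : Function.Injective f)
    (hg : Function.Surjective g) (hfg : Function.Exact f g) {X : ModuleCat.{u} Λ} {n : ℕ}
    (hI : Subsingleton (Ext X (ModuleCat.of Λ I) (n + 1)))
    (hQ : Subsingleton (Ext X (ModuleCat.of Λ Q) n)) :
    Subsingleton (Ext X (ModuleCat.of Λ K) (n + 1)) := by
  refine subsingleton_of_forall_eq 0 fun x => ?_
  obtain ⟨y, rfl⟩ := Ext.covariant_sequence_exact₁ X (moduleCat_shortExact_mk hf hg hfg)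
    x (hI.elim _ _) rfl
  rw [hQ.elim y 0, Ext.zero_comp]

theorem subsingleton_ext_cokernel (hf : Function.Injective f)
    (hg : Function.Surjective g) (hfg : Function.Exact f g) {Y : ModuleCat.{u} Λ} {n : ℕ}
    (hI : Subsingleton (Ext (ModuleCat.of Λ I) Y (n + 1)))
    (hK : Subsingleton (Ext (ModuleCat.of Λ K) Y n)) :
    Subsingleton (Ext (ModuleCat.of Λ Q) Y (n + 1)) := by
  refine subsingleton_of_forall_eq 0 fun x => ?_
  obtain ⟨y, rfl⟩ := Ext.contravariant_sequence_exact₃ (moduleCat_shortExact_mk hf hg hfg) Y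
    x (hI.elim _ _) (add_comm 1 n)
  rw [hK.elim y 0, Ext.comp_zero]

/-- Every class is the image of some `p : X → Q` under the connecting map, which kills whatever
lifts through `g`. -/
theorem subsingleton_ext_one_left_of_lift (hf : Function.Injective f)
    (hg : Function.Surjective g) (hfg : Function.Exact f g) {X : ModuleCat.{u} Λ}
    (hI : Subsingleton (Ext X (ModuleCat.of Λ I) 1))
    (h : ∀ p : X →ₗ[Λ] Q, ∃ q : X →ₗ[Λ] I, g ∘ₗ q = p) :
    Subsingleton (Ext X (ModuleCat.of Λ K) 1) := by
  refine subsingleton_of_forall_eq 0 fun x => ?_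
  have hS := moduleCat_shortExact_mk hf hg hfg
  obtain ⟨y, rfl⟩ := Ext.covariant_sequence_exact₁ X hS x (hI.elim _ _) (zero_add 1)
  obtain ⟨p, rfl⟩ := Ext.homEquiv₀.symm.surjective y
  obtain ⟨q, hq⟩ := h p.hom
  have hp : p = ModuleCat.ofHom q ≫ ModuleCat.ofHom g := ModuleCat.hom_ext hq.symm
  subst hp
  change (Ext.mk₀ _).comp hS.extClass _ = 0
  rw [← Ext.mk₀_comp_mk₀, Ext.comp_assoc_of_second_deg_zero, hS.comp_extClass, Ext.comp_zero]

theorem subsingleton_ext_one_cokernel_of_extension (hf : Function.Injective f)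
    (hg : Function.Surjective g) (hfg : Function.Exact f g) {Y : ModuleCat.{u} Λ}
    (hI : Subsingleton (Ext (ModuleCat.of Λ I) Y 1))
    (h : ∀ p : K →ₗ[Λ] Y, ∃ q : I →ₗ[Λ] Y, q ∘ₗ f = p) :
    Subsingleton (Ext (ModuleCat.of Λ Q) Y 1) := by
  refine subsingleton_of_forall_eq 0 fun x => ?_
  have hS := moduleCat_shortExact_mk hf hg hfg
  obtain ⟨y, rfl⟩ := Ext.contravariant_sequence_exact₃ hS Y x (hI.elim _ _) (add_zero 1)
  obtain ⟨p, rfl⟩ := Ext.homEquiv₀.symm.surjective y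
  obtain ⟨q, hq⟩ := h p.hom
  have hp : p = ModuleCat.ofHom f ≫ ModuleCat.ofHom q := ModuleCat.hom_ext hq.symm
  subst hp
  change hS.extClass.comp (Ext.mk₀ _) _ = 0
  rw [← Ext.mk₀_comp_mk₀, ← Ext.comp_assoc_of_second_deg_zero, hS.extClass_comp, Ext.zero_comp]

/-- For an injective copresentation `0 → K → I → Q → 0`, the module `X` is in `⊥K` if and only if
all maps `X → Q` lift to `I`. -/
theorem subsingleton_ext_iff_lift (hf : Function.Injective f)
    (hg : Function.Surjective g) (hfg : Function.Exact f g) [Module.Injective Λ I]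
    [Module.Injective Λ Q] {X : ModuleCat.{u} Λ} :
    (∀ i : ℕ, 1 ≤ i → Subsingleton (Ext X (ModuleCat.of Λ K) i)) ↔
      ∀ p : X →ₗ[Λ] Q, ∃ q : X →ₗ[Λ] I, g ∘ₗ q = p := by
  refine ⟨fun h => exists_lift_of_subsingleton_ext_one hf hg hfg (h 1 le_rfl), fun h i hi => ?_⟩
  match i, hi with
  | 1, _ =>
    exact subsingleton_ext_one_left_of_lift hf hg hfg (subsingleton_ext_of_injective I 0) h
  | i + 2, _ =>
    exact subsingleton_ext_left hf hg hfg (subsingleton_ext_of_injective I (i + 1))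
      (subsingleton_ext_of_injective Q i)

end ExtVanishing

/-! ### Approximations by cotilting modules, and uniqueness. -/

section CotiltingApproximation

open CategoryTheory Abelian

variable {R Λ : Type u} [CommRing R] [Ring Λ] [Algebra R Λ]

/-- If `D(Λ)` has a finite resolution in `add C`, then all maps from an object of `⊥C` to `D(Λ)`
lift to the first term of the resolution. -/
theorem HasFiniteAddResolution.exists_lift {C Z X : ModuleCat.{u} Λ}
    (h : HasFiniteAddResolution C Z) (hX : leftPerp C X) :
    ∃ (P : ModuleCat.{u} Λ) (ε : P →ₗ[Λ] Z), MemAdd P C ∧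
      ∀ p : X →ₗ[Λ] Z, ∃ q : X →ₗ[Λ] P, ε ∘ₗ q = p := by
  obtain ⟨s, P, d, ε, hP, hP0, hε, hd0, hd⟩ := h
  have hadd : ∀ i, MemAdd (P i) C := fun i => by
    rcases le_or_gt i s with hi | hi
    · exact hP i hi
    · have := hP0 i hi
      exact memAdd_of_subsingleton _ _
  -- Descending induction along the resolution: `m` bounds the steps left until the terms vanish,
  -- and each step shifts dimension in `0 → im d (j+1) → P (j+1) → im d j → 0`.
  have key : ∀ m j, s < j + m → ∀ i : ℕ, 1 ≤ i →
      Subsingleton (Ext X (ModuleCat.of Λ (LinearMap.range (d j))) i) := by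
    intro m
    induction m with
    | zero =>
      intro j hj i hi
      have := hP0 j hj
      exact (memAdd_of_subsingleton (ModuleCat.of Λ (LinearMap.range (d j))) C).subsingleton_ext
        (hX.2 i hi)
    | succ m ih =>
      intro j hj i hi
      refine subsingleton_ext_right (f := (LinearMap.range (d (j + 1))).subtype)
        (g := (d j).rangeRestrict) (Submodule.injective_subtype _)
        (LinearMap.surjective_rangeRestrict _) ?_ ((hadd (j + 1)).subsingleton_ext (hX.2 i hi))
        (ih (j + 1) (by omega) (i + 1) (by omega))
      intro x
      rw [Submodule.coe_subtype, Subtype.range_coe, ← Subtype.val_inj]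
      exact hd j x
  refine ⟨P 0, ε, hadd 0, exists_lift_of_subsingleton_ext_one
    (f := (LinearMap.range (d 0)).subtype) (Submodule.injective_subtype _) hε ?_
    (key (s + 1) 0 (by omega) 1 le_rfl)⟩
  intro x
  rw [Submodule.coe_subtype, Subtype.range_coe]
  exact hd0 x

variable (R) in
/-- Left `add C`-approximations. -/
theorem exists_left_approximation [IsArtinianRing R] [Module.Finite R Λ] (X C : ModuleCat.{u} Λ)
    [Module.Finite Λ X] [Module.Finite Λ C] :
    ∃ (k : ℕ) (f : X →ₗ[Λ] (Fin k → C)), ∀ g : X →ₗ[Λ] C,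
      ∃ h : (Fin k → C) →ₗ[Λ] C, h ∘ₗ f = g := by
  let _ : Module R X := Module.compHom X (algebraMap R Λ)
  let _ : Module R C := Module.compHom C (algebraMap R Λ)
  have : IsScalarTower R Λ X := IsScalarTower.of_algebraMap_smul fun _ _ => rfl
  have : IsScalarTower R Λ C := IsScalarTower.of_algebraMap_smul fun _ _ => rfl
  have : SMulCommClass Λ R C := IsScalarTower.to_smulCommClass'
  have : Module.Finite R X := Module.Finite.trans Λ X
  have : Module.Finite R C := Module.Finite.trans Λ C
  -- Finitely many `R`-generators of `Hom_Λ(X, C)` are the components of the approximation.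
  have hfin : Module.Finite R (X →ₗ[Λ] C) := by
    let F : (X →ₗ[Λ] C) →ₗ[R] (X →ₗ[R] C) :=
      { toFun := fun g => g.restrictScalars R
        map_add' := fun _ _ => rfl
        map_smul' := fun _ _ => rfl }
    exact Module.Finite.of_injective F fun a b hab =>
      LinearMap.ext fun x => LinearMap.congr_fun hab x
  obtain ⟨k, G, hG⟩ := Module.Finite.exists_fin (R := R) (M := X →ₗ[Λ] C)
  refine ⟨k, LinearMap.pi G, fun g => ?_⟩
  have hg : g ∈ Submodule.span R (Set.range G) := hG ▸ Submodule.mem_top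
  obtain ⟨c, rfl⟩ := (Submodule.mem_span_range_iff_exists_fun R).mp hg
  refine ⟨∑ j, c j • LinearMap.proj j, LinearMap.ext fun x => ?_⟩
  rw [LinearMap.comp_apply, LinearMap.sum_apply, LinearMap.sum_apply]
  rfl

/-- An object of `⊥C` embeds into a finite sum of copies of `C`, with cokernel in `⊥C`. -/
theorem exists_coresolution [IsArtinianRing R] [Module.Finite R Λ] {X C : ModuleCat.{u} Λ}
    [Module.Finite Λ C] (hself : ∀ i : ℕ, 1 ≤ i → Subsingleton (Ext C C i))
    (hres : HasFiniteAddResolution C (ModuleCat.of Λ (DualRegular R Λ)))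
    (hX : leftPerp C X) :
    ∃ (k : ℕ) (f : X →ₗ[Λ] (Fin k → C)), Function.Injective f ∧
      leftPerp C (ModuleCat.of Λ ((Fin k → C) ⧸ LinearMap.range f)) := by
  have := hX.1
  obtain ⟨k, f, hf⟩ := exists_left_approximation R X C
  -- An `x` killed by `f` is killed by every map to `C`, hence by every map to a module in `add C`.
  -- But a map to `D(Λ)` that does not kill `x` would lift to such a module.
  have hinj : Function.Injective f := by
    rw [← LinearMap.ker_eq_bot, LinearMap.ker_eq_bot']
    intro x hx
    by_contra hx0
    obtain ⟨φ, hφ⟩ := DualRegular.exists_hom_ne_zero (R := R) (Λ := Λ) hx0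
    obtain ⟨P, ε, hP, hlift⟩ := hres.exists_lift hX
    obtain ⟨q, hq⟩ := hlift φ
    obtain ⟨m, a, b, hab⟩ := memAdd_iff.mp hP
    have hqx : q x = 0 := by
      have h1 := LinearMap.congr_fun hab (q x)
      rw [LinearMap.sum_apply] at h1
      rw [← LinearMap.id_apply (R := Λ) (q x), ← h1]
      refine Finset.sum_eq_zero fun j _ => ?_
      obtain ⟨h, hh⟩ := hf (a j ∘ₗ q)
      have h2 : h (f x) = a j (q x) := LinearMap.congr_fun hh x
      rw [LinearMap.comp_apply, ← h2, hx, map_zero, map_zero]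
    refine hφ ?_
    rw [← hq, LinearMap.comp_apply, hqx, map_zero]
  have hpow : MemAdd (ModuleCat.of Λ (Fin k → C)) C :=
    memAdd_of_retract (k := k) LinearMap.id LinearMap.id fun _ => rfl
  refine ⟨k, f, hinj, inferInstanceAs (Module.Finite Λ ((Fin k → C) ⧸ LinearMap.range f)),
    fun i hi => ?_⟩
  -- Degree 1 uses the approximation property of `f`; higher degrees are dimension shifting.
  match i, hi with
  | 1, _ =>
    exact subsingleton_ext_one_cokernel_of_extension hinj (Submodule.mkQ_surjective _)
      (LinearMap.exact_map_mkQ_range f) (hpow.subsingleton_ext' (hself 1 le_rfl)) hf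
  | i + 2, _ =>
    exact subsingleton_ext_cokernel hinj (Submodule.mkQ_surjective _)
      (LinearMap.exact_map_mkQ_range f) (hpow.subsingleton_ext' (hself _ (by omega)))
      (hX.2 _ (by omega))

/-- `T` embeds into `C^k` with cokernel in `⊥C = ⊥T`, and the vanishing of `Ext^1(coker, T)` splits
the embedding. -/
theorem memAdd_of_leftPerp_eq [IsArtinianRing R] [Module.Finite R Λ] {r : ℕ}
    {T C : ModuleCat.{u} Λ} (hC : IsCotilting R r C) (hT : leftPerp T T)
    (h : leftPerp C = leftPerp T) : MemAdd T C := by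
  have := hC.finite
  obtain ⟨k, f, hf, hcoker⟩ := exists_coresolution hC.ext_self hC.resolution (h ▸ hT)
  rw [h] at hcoker
  obtain ⟨g, hg⟩ := exists_extension_of_subsingleton_ext_one hf (Submodule.mkQ_surjective _)
    (LinearMap.exact_map_mkQ_range f) (hcoker.2 1 le_rfl) LinearMap.id
  exact memAdd_of_retract f g (LinearMap.congr_fun hg)

/-- Cotilting modules with the same left perpendicular category have the same indecomposable direct
summands. -/
theorem IsCotilting.isDirectSummand_of_leftPerp_eq [IsArtinianRing R] [Module.Finite R Λ] {r s : ℕ}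
    {C T : ModuleCat.{u} Λ} (hC : IsCotilting R r C) (hT : IsCotilting R s T)
    (h : leftPerp C = leftPerp T) {N : ModuleCat.{u} Λ} (hN : IsIndecomposableModule N)
    (hNC : IsDirectSummand N C) : IsDirectSummand N T := by
  have hfinC := hC.finite
  have hNfin : Module.Finite Λ N := by
    obtain ⟨f, g, hfg⟩ := isDirectSummand_iff.mp hNC
    exact Module.Finite.of_surjective g fun x => ⟨f x, LinearMap.congr_fun hfg x⟩
  have : IsArtinianRing Λ := IsArtinianRing.of_finite R Λ
  have : IsNoetherianRing Λ := IsNoetherianRing.of_finite R Λ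
  exact hN.isDirectSummand_of_memAdd
    (hNC.memAdd (memAdd_of_leftPerp_eq hT ⟨hC.finite, hC.ext_self⟩ h.symm))

end CotiltingApproximation

/-! ### Triangular matrices acting on columns. -/

section UpperTriangular

variable (R A : Type u) [CommRing R] [Ring A] [Algebra R A] {n : ℕ}

/-- The matrix unit `e_{ij}` if `i ≤ j`, and zero otherwise. -/
def UpperTri.unitOrZero (i j : Fin n) : UpperTri R A n :=
  if h : i ≤ j then UpperTri.unit R A i j h else 0

variable {R A}

theorem UpperTri.unitOrZero_of_le {i j : Fin n} (h : i ≤ j) :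
    UpperTri.unitOrZero R A i j = UpperTri.unit R A i j h :=
  dif_pos h

theorem UpperTri.unitOrZero_of_not_le {i j : Fin n} (h : ¬ i ≤ j) :
    UpperTri.unitOrZero R A i j = 0 :=
  dif_neg h

theorem UpperTri.coe_unitOrZero {i j : Fin n} (h : i ≤ j) :
    (UpperTri.unitOrZero R A i j).1 = Matrix.single i j 1 := by
  rw [UpperTri.unitOrZero_of_le h]
  rfl

theorem UpperTri.coe_diag (a : A) : (UpperTri.diag R A n a).1 = Matrix.diagonal fun _ => a :=
  rfl

theorem UpperTri.unitOrZero_mul_unitOrZero {i j k : Fin n} (hij : i ≤ j) (hjk : j ≤ k) :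
    UpperTri.unitOrZero R A i j * UpperTri.unitOrZero R A j k = UpperTri.unitOrZero R A i k := by
  rw [unitOrZero_of_le hij, unitOrZero_of_le hjk, unitOrZero_of_le (hij.trans hjk),
    UpperTri.unit_mul_unit]

theorem UpperTri.unitOrZero_mul_diag (i j : Fin n) (a : A) :
    UpperTri.unitOrZero R A i j * UpperTri.diag R A n a =
      UpperTri.diag R A n a * UpperTri.unitOrZero R A i j := by
  by_cases h : i ≤ j
  · rw [unitOrZero_of_le h, UpperTri.unit_mul_diag]
  · rw [unitOrZero_of_not_le h, zero_mul, mul_zero]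

/-- The sum may run over all `k`: for `k < i ≤ j` both `b.1 j k` and `unitOrZero` vanish. -/
theorem UpperTri.unitOrZero_mul {i j : Fin n} (hij : i ≤ j) (b : UpperTri R A n) :
    UpperTri.unitOrZero R A i j * b =
      ∑ k, UpperTri.diag R A n (b.1 j k) * UpperTri.unitOrZero R A i k := by
  refine Subtype.ext ?_
  rw [AddSubmonoidClass.coe_finsetSum]
  change (UpperTri.unitOrZero R A i j).1 * b.1 =
    ∑ k, ((Matrix.diagonal fun _ => b.1 j k) * (UpperTri.unitOrZero R A i k).1 :
      Matrix (Fin n) (Fin n) A)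
  rw [coe_unitOrZero hij]
  ext r c
  rw [Matrix.sum_apply]
  have hterm : ∀ k, ((Matrix.diagonal fun _ => b.1 j k) * (UpperTri.unitOrZero R A i k).1 :
      Matrix (Fin n) (Fin n) A) r c = if k = c then (if i = r then b.1 j c else 0) else 0 := by
    intro k
    rw [Matrix.diagonal_mul]
    by_cases hik : i ≤ k
    · rw [coe_unitOrZero hik, Matrix.single_apply]
      by_cases h1 : i = r <;> by_cases h2 : k = c <;> simp [h1, h2]
    · have hb : b.1 j k = 0 := b.2 (lt_of_lt_of_le (not_le.mp hik) hij)
      rw [hb, zero_mul]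
      by_cases h2 : k = c
      · subst h2
        simp [hb]
      · simp [h2]
  rw [Finset.sum_congr rfl fun k _ => hterm k, Finset.sum_ite_eq' Finset.univ c,
    if_pos (Finset.mem_univ c)]
  by_cases h1 : i = r
  · subst h1
    simp
  · rw [Matrix.single_mul_apply_of_ne _ _ _ _ _ (Ne.symm h1), if_neg h1]

variable {M : Type u} [AddCommGroup M] [Module A M]

variable (R A) in
/-- The column with given entries. -/
def Column.of (v : Fin n → M) : Column R A n M :=
  v

theorem Column.add_apply (x y : Column R A n M) (i : Fin n) : (x + y) i = x i + y i :=
  rfl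

theorem Column.diag_smul_apply (a : A) (x : Column R A n M) (i : Fin n) :
    (UpperTri.diag R A n a • x) i = a • x i := by
  rw [Column.smul_apply, UpperTri.coe_diag, Finset.sum_eq_single i]
  · rw [Matrix.diagonal_apply_eq]
  · intro j _ hj
    rw [Matrix.diagonal_apply_ne _ hj.symm, zero_smul]
  · exact fun h => absurd (Finset.mem_univ i) h

theorem Column.unitOrZero_smul_apply {i j : Fin n} (h : i ≤ j) (x : Column R A n M) (k : Fin n) :
    (UpperTri.unitOrZero R A i j • x) k = if k = i then x j else 0 := by
  rw [Column.smul_apply, UpperTri.coe_unitOrZero h, Finset.sum_eq_single j]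
  · by_cases hk : k = i
    · subst hk
      simp
    · rw [Matrix.single_apply_of_row_ne (Ne.symm hk), zero_smul, if_neg hk]
  · intro l _ hl
    rw [Matrix.single_apply_of_col_ne _ _ hl.symm, zero_smul]
  · exact fun h => absurd (Finset.mem_univ j) h

variable (R A n M) in
/-- The columns over `M` whose entries at the positions `j ≥ i` vanish. -/
def headColumn (i : Fin n) : Submodule (UpperTri R A n) (Column R A n M) where
  carrier := {x | ∀ j, i ≤ j → x j = 0}
  add_mem' {x y} hx hy j hj := by
    rw [Column.add_apply, hx j hj, hy j hj, add_zero]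
  zero_mem' _ _ := rfl
  smul_mem' a x hx j hj := by
    rw [Column.smul_apply]
    refine Finset.sum_eq_zero fun k _ => ?_
    rcases lt_or_ge k j with hk | hk
    · rw [a.2 hk, zero_smul]
    · rw [hx k (hj.trans hk), smul_zero]

variable (R A n M) in
/-- The columns over `M` with entries at the positions `j ≥ i` only, as a quotient of the module of
all columns. -/
abbrev tailColumn (i : Fin n) : Type u :=
  Column R A n M ⧸ headColumn R A n M i

theorem tailColumn.mkQ_eq_iff {i : Fin n} {x y : Column R A n M} :
    (headColumn R A n M i).mkQ x = (headColumn R A n M i).mkQ y ↔ ∀ j, i ≤ j → x j = y j := by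
  rw [Submodule.mkQ_apply, Submodule.mkQ_apply, Submodule.Quotient.eq]
  exact forall₂_congr fun j _ => sub_eq_zero

/-- The entry at position `i`. -/
noncomputable def tailColumn.coord {i : Fin n} (q : tailColumn R A n M i) : M :=
  (Function.surjInv (headColumn R A n M i).mkQ_surjective q) i

theorem tailColumn.coord_mkQ {i : Fin n} (x : Column R A n M) :
    tailColumn.coord ((headColumn R A n M i).mkQ x) = x i :=
  tailColumn.mkQ_eq_iff.mp
    (Function.surjInv_eq (headColumn R A n M i).mkQ_surjective ((headColumn R A n M i).mkQ x)) i
    le_rfl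

/-! ### Truncated columns as coinduced modules. -/

section Adjunction

variable {Y : Type u} [AddCommGroup Y] [Module (UpperTri R A n) Y] [Module A Y]
  (hY : ∀ (a : A) (y : Y), a • y = UpperTri.diag R A n a • y)

include hY

theorem UpperTri.map_unitOrZero_smul (h : Y →ₗ[A] M) {i j : Fin n} (hij : i ≤ j)
    (b : UpperTri R A n) (y : Y) :
    h (UpperTri.unitOrZero R A i j • b • y) =
      ∑ k, b.1 j k • h (UpperTri.unitOrZero R A i k • y) := by
  rw [← mul_smul, UpperTri.unitOrZero_mul hij, Finset.sum_smul, map_sum]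
  refine Finset.sum_congr rfl fun k _ => ?_
  rw [mul_smul, ← hY, map_smul]

/-- The `T_n(A)`-linear map to the columns that corresponds to an `A`-linear map to `M`. -/
def UpperTri.homColumn {o : Fin n} (ho : ∀ j, o ≤ j) (h : Y →ₗ[A] M) :
    Y →ₗ[UpperTri R A n] Column R A n M where
  toFun y j := h (UpperTri.unitOrZero R A o j • y)
  map_add' x y := funext fun j => by rw [smul_add, map_add]; rfl
  map_smul' b y := funext fun j => UpperTri.map_unitOrZero_smul hY h (ho j) b y

/-- The `T_n(A)`-linear map to the truncated columns that corresponds to an `A`-linear map to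
`M`. -/
def UpperTri.homTailColumn (i : Fin n) (h : Y →ₗ[A] M) :
    Y →ₗ[UpperTri R A n] tailColumn R A n M i where
  toFun y := (headColumn R A n M i).mkQ (Column.of R A fun j => h (UpperTri.unitOrZero R A i j • y))
  map_add' x y := by
    rw [← map_add, tailColumn.mkQ_eq_iff]
    intro j _
    exact (congrArg h (smul_add _ x y)).trans (map_add h _ _)
  map_smul' b y := by
    rw [RingHom.id_apply, ← map_smul, tailColumn.mkQ_eq_iff]
    intro j hj
    exact UpperTri.map_unitOrZero_smul hY h hj b y

/-- The `A`-linear map that corresponds to a `T_n(A)`-linear map to the truncated columns. -/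
noncomputable def tailColumn.coordHom {i : Fin n} (p : Y →ₗ[UpperTri R A n] tailColumn R A n M i) :
    Y →ₗ[A] M where
  toFun y := tailColumn.coord (p y)
  map_add' x y := by
    obtain ⟨v, hv⟩ := (headColumn R A n M i).mkQ_surjective (p x)
    obtain ⟨w, hw⟩ := (headColumn R A n M i).mkQ_surjective (p y)
    rw [map_add, ← hv, ← hw, ← map_add, tailColumn.coord_mkQ, tailColumn.coord_mkQ,
      tailColumn.coord_mkQ]
    rfl
  map_smul' a y := by
    obtain ⟨w, hw⟩ := (headColumn R A n M i).mkQ_surjective (p y)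
    rw [hY, map_smul, ← hw, ← map_smul, tailColumn.coord_mkQ, tailColumn.coord_mkQ,
      Column.diag_smul_apply]
    rfl

/-- Multiplication by `e_{ij}` moves the entry at `j` to position `i`, so the `i`-th coordinate
alone determines `p`. -/
theorem tailColumn.coordHom_unitOrZero_smul {i : Fin n}
    (p : Y →ₗ[UpperTri R A n] tailColumn R A n M i) {y : Y} {v : Column R A n M}
    (hv : (headColumn R A n M i).mkQ v = p y) {j : Fin n} (hj : i ≤ j) :
    tailColumn.coordHom hY p (UpperTri.unitOrZero R A i j • y) = v j := by
  change tailColumn.coord (p _) = _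
  rw [map_smul, ← hv, ← map_smul, tailColumn.coord_mkQ, Column.unitOrZero_smul_apply hj,
    if_pos rfl]

end Adjunction

variable (R n) in
/-- The `A`-module structure on a `T_n(A)`-module. -/
@[reducible] def UpperTri.restrictModule (Y : Type u) [AddCommGroup Y]
    [Module (UpperTri R A n) Y] : Module A Y :=
  Module.compHom Y (UpperTri.diag R A n)

/-- By the adjunction, a map to `tailColumn` extends as soon as its `i`-th coordinate extends as an
`A`-linear map to `M`. -/
instance tailColumn.injective [Module.Injective A M] (i : Fin n) :
    Module.Injective (UpperTri R A n) (tailColumn R A n M i) where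
  out Y Z _ _ _ _ f hf g := by
    let _ : Module A Y := UpperTri.restrictModule R n Y
    let _ : Module A Z := UpperTri.restrictModule R n Z
    have hY : ∀ (a : A) (y : Y), a • y = UpperTri.diag R A n a • y := fun _ _ => rfl
    have hZ : ∀ (a : A) (y : Z), a • y = UpperTri.diag R A n a • y := fun _ _ => rfl
    let f' : Y →ₗ[A] Z :=
      { toFun := f
        map_add' := map_add f
        map_smul' := fun a y => map_smul f (UpperTri.diag R A n a) y }
    obtain ⟨h, hh⟩ := Module.Injective.extension_property A M _ _ f' hf (tailColumn.coordHom hY g)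
    refine ⟨UpperTri.homTailColumn hZ i h, fun y => ?_⟩
    obtain ⟨v, hv⟩ := (headColumn R A n M i).mkQ_surjective (g y)
    rw [← hv]
    refine tailColumn.mkQ_eq_iff.mpr fun j hj => ?_
    change h (UpperTri.unitOrZero R A i j • f y) = v j
    rw [← map_smul, ← tailColumn.coordHom_unitOrZero_smul hY g hv hj]
    exact LinearMap.congr_fun hh _

theorem headColumn_eq_bot {o : Fin n} (ho : ∀ j, o ≤ j) : headColumn R A n M o = ⊥ := by
  rw [Submodule.eq_bot_iff]
  exact fun x hx => funext fun j => hx j (ho j)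

instance Column.injective [NeZero n] [Module.Injective A M] :
    Module.Injective (UpperTri R A n) (Column R A n M) := by
  refine Module.Baer.injective (Module.Baer.of_equiv
    (Submodule.quotEquivOfEqBot _ (headColumn_eq_bot (R := R) (A := A) (M := M) Fin.zero_le))
    (Module.Baer.of_injective inferInstance))

/-- If the structure map from the `i`-th to the `o`-th branch of `X` is injective, then all maps from
`X` to truncated columns lift. -/
theorem exists_lift_tailColumn_of_injective [Module.Injective A M] {X : Type u} [AddCommGroup X]
    [Module (UpperTri R A n) X] {o i : Fin n} (ho : ∀ j, o ≤ j)
    (hX : ∀ x : X, UpperTri.unitOrZero R A i i • x = x → UpperTri.unitOrZero R A o i • x = 0 →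
      x = 0) (p : X →ₗ[UpperTri R A n] tailColumn R A n M i) :
    ∃ q : X →ₗ[UpperTri R A n] Column R A n M, (headColumn R A n M i).mkQ ∘ₗ q = p := by
  let _ : Module A X := UpperTri.restrictModule R n X
  have hA : ∀ (a : A) (x : X), a • x = UpperTri.diag R A n a • x := fun _ _ => rfl
  let E : Fin n → X →ₗ[A] X := fun k =>
    { toFun := fun x => UpperTri.unitOrZero R A k i • x
      map_add' := smul_add _
      map_smul' := fun a x => by
        rw [hA, RingHom.id_apply, hA, ← mul_smul, ← mul_smul, UpperTri.unitOrZero_mul_diag] }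
  have hinj : Function.Injective ((E o).domRestrict (LinearMap.range (E i))) := by
    rw [← LinearMap.ker_eq_bot, LinearMap.ker_eq_bot']
    rintro ⟨_, x, rfl⟩ hx
    refine Subtype.ext (hX _ ?_ hx)
    change UpperTri.unitOrZero R A i i • UpperTri.unitOrZero R A i i • x =
      UpperTri.unitOrZero R A i i • x
    rw [← mul_smul, UpperTri.unitOrZero_mul_unitOrZero le_rfl le_rfl]
  -- The coordinate of `p` on the `i`-th branch is extended along the injection `e_{oi}` of that
  -- branch into `X`; the extension `h` defines the lift to columns.
  obtain ⟨h, hh⟩ := Module.Injective.extension_property A M _ _ _ hinj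
    ((tailColumn.coordHom hA p).domRestrict (LinearMap.range (E i)))
  refine ⟨UpperTri.homColumn hA ho h, LinearMap.ext fun x => ?_⟩
  obtain ⟨v, hv⟩ := (headColumn R A n M i).mkQ_surjective (p x)
  rw [← hv]
  refine tailColumn.mkQ_eq_iff.mpr fun j hj => ?_
  rw [← tailColumn.coordHom_unitOrZero_smul hA p hv hj]
  have h1 := LinearMap.congr_fun hh ⟨UpperTri.unitOrZero R A i j • x,
    UpperTri.unitOrZero R A i j • x, by
      change UpperTri.unitOrZero R A i i • UpperTri.unitOrZero R A i j • x = _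
      rw [← mul_smul, UpperTri.unitOrZero_mul_unitOrZero le_rfl hj]⟩
  change h (UpperTri.unitOrZero R A o i • UpperTri.unitOrZero R A i j • x) = _ at h1
  rw [← mul_smul, UpperTri.unitOrZero_mul_unitOrZero (ho i) hj] at h1
  exact h1

/-- If `M` is a cogenerator, the converse holds. -/
theorem injective_of_exists_lift_tailColumn {X : Type u} [AddCommGroup X]
    [Module (UpperTri R A n) X] {o i : Fin n} (ho : ∀ j, o ≤ j)
    (hM : ∀ (Y : Type u) [AddCommGroup Y] [Module A Y] (y : Y), y ≠ 0 →
      ∃ f : Y →ₗ[A] M, f y ≠ 0)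
    (hlift : ∀ p : X →ₗ[UpperTri R A n] tailColumn R A n M i,
      ∃ q : X →ₗ[UpperTri R A n] Column R A n M, (headColumn R A n M i).mkQ ∘ₗ q = p)
    (x : X) (hx : UpperTri.unitOrZero R A i i • x = x)
    (hx0 : UpperTri.unitOrZero R A o i • x = 0) : x = 0 := by
  let _ : Module A X := UpperTri.restrictModule R n X
  have hA : ∀ (a : A) (x : X), a • x = UpperTri.diag R A n a • x := fun _ _ => rfl
  by_contra hne
  -- For the lift `q` of the map defined by `h`, the entry `q x i` equals `h x`; it is also an entry
  -- of `e_{oi} • q x = q (e_{oi} • x) = 0`.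
  obtain ⟨h, hh⟩ := hM X x hne
  obtain ⟨q, hq⟩ := hlift (UpperTri.homTailColumn hA i h)
  have h1 : q x i = h (UpperTri.unitOrZero R A i i • x) :=
    tailColumn.mkQ_eq_iff.mp (LinearMap.congr_fun hq x) i le_rfl
  have h2 : (UpperTri.unitOrZero R A o i • q x) o = q x i := by
    rw [Column.unitOrZero_smul_apply (ho i), if_pos rfl]
  rw [← map_smul, hx0, map_zero] at h2
  refine hh ?_
  rw [← hx, ← h1, ← h2]
  rfl

end UpperTriangular

/-! ### The monomorphism category as a left perpendicular category. -/

section MonomorphismCategory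

open CategoryTheory Abelian

variable {R A : Type u} [CommRing R] [Ring A] [Algebra R A] {n : ℕ}

/-- All consecutive maps are injective if and only if all composites into the branch at the least
index `o` are; the composites are what the Ext computation detects. -/
theorem mem_monoCat_iff {o : Fin n} (ho : ∀ j, o ≤ j) {Y : ModuleCat.{u} (UpperTri R A n)} :
    monoCat R A n Y ↔ Module.Finite (UpperTri R A n) Y ∧ ∀ (i : Fin n) (y : Y),
      UpperTri.unitOrZero R A i i • y = y → UpperTri.unitOrZero R A o i • y = 0 → y = 0 := by
  refine and_congr_right fun _ => ⟨fun h => ?_, fun h i hi => ?_⟩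
  · have h' : ∀ (i : ℕ) (hi : i + 1 < n) (y : Y),
        UpperTri.unitOrZero R A ⟨i + 1, hi⟩ ⟨i + 1, hi⟩ • y = y →
        UpperTri.unitOrZero R A ⟨i, Nat.lt_of_succ_lt hi⟩ ⟨i + 1, hi⟩ • y = 0 → y = 0 := by
      intro i hi y hy h0
      rw [UpperTri.unitOrZero_of_le le_rfl] at hy
      rw [UpperTri.unitOrZero_of_le (Nat.le_succ i)] at h0
      let y' : UpperTri.branch Y ⟨i + 1, hi⟩ := ⟨y, hy⟩
      have : y' = 0 := h i hi (Subtype.ext (h0.trans (smul_zero _).symm))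
      exact congrArg Subtype.val this
    rintro ⟨i, hi⟩
    induction i with
    | zero =>
      intro y hy h0
      have : o = ⟨0, hi⟩ := le_antisymm (ho _) (Nat.zero_le _)
      subst this
      rw [← hy, h0]
    | succ i ih =>
      intro y hy h0
      have hle : (⟨i, Nat.lt_of_succ_lt hi⟩ : Fin n) ≤ ⟨i + 1, hi⟩ := Nat.le_succ i
      refine h' i hi y hy (ih (Nat.lt_of_succ_lt hi) _ ?_ ?_)
      · rw [← mul_smul, UpperTri.unitOrZero_mul_unitOrZero le_rfl hle]
      · rw [← mul_smul, UpperTri.unitOrZero_mul_unitOrZero (ho _) hle, h0]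
  · change Function.Injective (UpperTri.branchMap Y ⟨i, Nat.lt_of_succ_lt hi⟩ ⟨i + 1, hi⟩
      (Nat.le_succ i))
    rw [← LinearMap.ker_eq_bot, LinearMap.ker_eq_bot']
    rintro ⟨y, hy⟩ hy0
    have hle : (⟨i, Nat.lt_of_succ_lt hi⟩ : Fin n) ≤ ⟨i + 1, hi⟩ := Nat.le_succ i
    have h0 : UpperTri.unit R A ⟨i, Nat.lt_of_succ_lt hi⟩ ⟨i + 1, hi⟩ (Nat.le_succ i) •
        (show Y from y) = 0 := congrArg Subtype.val hy0
    refine Subtype.ext (h ⟨i + 1, hi⟩ y ?_ ?_)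
    · rw [UpperTri.unitOrZero_of_le le_rfl]
      exact hy
    · rw [← UpperTri.unitOrZero_mul_unitOrZero (ho _) hle, UpperTri.unitOrZero_of_le hle]
      exact (mul_smul _ _ (show Y from y)).trans ((congrArg _ h0).trans (smul_zero _))

variable {M : Type u} [AddCommGroup M] [Module A M]

theorem headColumn_eq_mBranch {i k : Fin n} (h : k.1 + 1 = i.1) :
    headColumn R A n M i = mBranch R A n M k := by
  ext x
  refine forall_congr' fun j => ?_
  rw [Fin.le_def, Fin.lt_def, ← h, Nat.succ_le_iff]

theorem mBranch_eq_top {l : Fin n} (hl : ∀ j, j ≤ l) : mBranch R A n M l = ⊤ :=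
  eq_top_iff.mpr fun _ _ j hj => absurd hj (not_lt.mpr (hl j))

theorem subsingleton_ext_headColumn_iff [NeZero n] [Module.Injective A M]
    {X : ModuleCat.{u} (UpperTri R A n)} (i : Fin n) :
    (∀ j : ℕ, 1 ≤ j → Subsingleton (Ext X (ModuleCat.of _ (headColumn R A n M i)) j)) ↔
      ∀ p : X →ₗ[UpperTri R A n] tailColumn R A n M i,
        ∃ q : X →ₗ[UpperTri R A n] Column R A n M, (headColumn R A n M i).mkQ ∘ₗ q = p :=
  subsingleton_ext_iff_lift (Submodule.injective_subtype _) (Submodule.mkQ_surjective _)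
    (LinearMap.exact_subtype_mkQ _)

theorem subsingleton_ext_headColumn [NeZero n] [Module.Injective A M]
    {X : ModuleCat.{u} (UpperTri R A n)} (i : Fin n) (j : ℕ) :
    Subsingleton (Ext X (ModuleCat.of _ (headColumn R A n M i)) (j + 2)) :=
  subsingleton_ext_left (Submodule.injective_subtype _) (Submodule.mkQ_surjective _)
    (LinearMap.exact_subtype_mkQ _) (subsingleton_ext_of_injective _ _)
    (subsingleton_ext_of_injective _ _)

theorem subsingleton_ext_mBranch_of_forall_le [NeZero n] [Module.Injective A M]
    {X : ModuleCat.{u} (UpperTri R A n)} {l : Fin n} (hl : ∀ j, j ≤ l) (j : ℕ) :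
    Subsingleton (Ext X (ModuleCat.of _ (mBranch R A n M l)) (j + 1)) := by
  rw [mBranch_eq_top hl]
  have := Module.Baer.injective (Module.Baer.of_equiv (R := UpperTri R A n)
    (Q := Column R A n M) (M := (⊤ : Submodule (UpperTri R A n) (Column R A n M)))
    Submodule.topEquiv.symm (Module.Baer.of_injective inferInstance))
  exact subsingleton_ext_of_injective _ j

theorem exists_succ_eq_or_forall_le (i : Fin n) :
    (∃ k : Fin n, i.1 + 1 = k.1) ∨ ∀ j, j ≤ i := by
  by_cases h : i.1 + 1 < n
  · exact Or.inl ⟨⟨i.1 + 1, h⟩, rfl⟩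
  · exact Or.inr fun j => Fin.le_def.mpr (by omega)

/-- If `M` is an injective cogenerator, the monomorphism category is the left perpendicular category
of `m(M)`. -/
theorem monoCat_eq_leftPerp_mModule [NeZero n] [Module.Injective A M]
    (hM : ∀ (Y : Type u) [AddCommGroup Y] [Module A Y] (y : Y), y ≠ 0 →
      ∃ f : Y →ₗ[A] M, f y ≠ 0) :
    monoCat R A n = leftPerp (mModule R A n M) := by
  ext X
  rw [mem_monoCat_iff (o := 0) Fin.zero_le]
  refine and_congr_right fun _ => ⟨fun h j hj => ?_, fun h i => ?_⟩
  · refine subsingleton_ext_pi (fun i => mBranch R A n M i) fun i => ?_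
    -- Every summand except the last is a `headColumn`; the last is the full, injective, column
    -- module.
    rcases exists_succ_eq_or_forall_le i with ⟨k, hk⟩ | hi
    · rw [← headColumn_eq_mBranch hk]
      exact (subsingleton_ext_headColumn_iff k).mpr
        (exists_lift_tailColumn_of_injective Fin.zero_le (h k)) j hj
    · obtain ⟨j, rfl⟩ := Nat.exists_eq_succ_of_ne_zero (Nat.one_le_iff_ne_zero.mp hj)
      exact subsingleton_ext_mBranch_of_forall_le hi j
  · by_cases hi : i = 0
    · intro y hy h0
      subst hi
      rw [← hy, h0]
    · have hk : (⟨i.1 - 1, by omega⟩ : Fin n).1 + 1 = i.1 :=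
        Nat.succ_pred_eq_of_ne_zero fun h0 => hi (Fin.ext h0)
      refine injective_of_exists_lift_tailColumn Fin.zero_le hM
        ((subsingleton_ext_headColumn_iff i).mp fun j hj => ?_)
      rw [headColumn_eq_mBranch hk]
      exact subsingleton_ext_of_subsingleton_ext_pi (fun i => mBranch R A n M i) (h j hj) _

theorem hasInjectiveDimensionLE_mModule [NeZero n] [Module.Injective A M] :
    HasInjectiveDimensionLE (mModule R A n M) 1 := by
  refine HasInjectiveDimensionLT.mk fun j hj X e => ?_
  obtain ⟨j, rfl⟩ := Nat.exists_eq_add_of_le' hj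
  have : Subsingleton (Ext X (mModule R A n M) (j + 2)) := by
    refine subsingleton_ext_pi (fun i => mBranch R A n M i) fun i => ?_
    rcases exists_succ_eq_or_forall_le i with ⟨k, hk⟩ | hi
    · rw [← headColumn_eq_mBranch hk]
      exact subsingleton_ext_headColumn k j
    · exact subsingleton_ext_mBranch_of_forall_le hi (j + 1)
  exact this.elim _ _

section Finite

instance UpperTri.finite [IsNoetherianRing R] [Module.Finite R A] :
    Module.Finite R (UpperTri R A n) :=
  have : Module.Finite R (Matrix (Fin n) (Fin n) A) :=
    inferInstanceAs (Module.Finite R (Fin n → Fin n → A))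
  Module.Finite.of_injective
    (Matrix.blockTriangularSubalgebra R A (id : Fin n → Fin n)).val.toLinearMap
    Subtype.val_injective

instance Column.finite [Module.Finite R A] [Module.Finite A M] :
    Module.Finite (UpperTri R A n) (Column R A n M) := by
  let _ : Module R M := Module.compHom M (algebraMap R A)
  let _ : Module R (Column R A n M) := Module.compHom _ (algebraMap R (UpperTri R A n))
  have : IsScalarTower R A M := IsScalarTower.of_algebraMap_smul fun _ _ => rfl
  have : IsScalarTower R (UpperTri R A n) (Column R A n M) :=
    IsScalarTower.of_algebraMap_smul fun _ _ => rfl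
  have : Module.Finite R M := Module.Finite.trans A M
  let e : (Fin n → M) ≃ₗ[R] Column R A n M :=
    { AddEquiv.refl (Fin n → M) with
      map_smul' := fun r x => funext fun i =>
        (Column.diag_smul_apply (R := R) (algebraMap R A r) (Column.of R A x) i).symm }
  have := Module.Finite.equiv e
  exact Module.Finite.of_restrictScalars_finite R _ _

theorem finite_mModule [IsNoetherianRing R] [Module.Finite R A] [Module.Finite A M] :
    Module.Finite (UpperTri R A n) (mModule R A n M) := by
  have : IsNoetherianRing (UpperTri R A n) := IsNoetherianRing.of_finite R _
  exact inferInstanceAs (Module.Finite (UpperTri R A n) (∀ i : Fin n, mBranch R A n M i))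

/-- Once `S_n(A)` is known to be the left perpendicular category of `m(M)`, this gives the vanishing
of the self-extensions. -/
theorem mModule_mem_monoCat [NeZero n] [IsNoetherianRing R] [Module.Finite R A]
    [Module.Finite A M] : monoCat R A n (mModule R A n M) := by
  refine (mem_monoCat_iff (o := 0) Fin.zero_le).mpr ⟨finite_mModule, fun i t ht h0 => ?_⟩
  funext c
  refine Subtype.ext (funext fun k => ?_)
  have h1 : (UpperTri.unitOrZero R A i i • (t c).1) k = (t c).1 k :=
    congrFun (congrArg Subtype.val (congrFun ht c)) k
  have h2 : (UpperTri.unitOrZero R A 0 i • (t c).1) 0 = 0 :=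
    congrFun (congrArg Subtype.val (congrFun h0 c)) 0
  rw [Column.unitOrZero_smul_apply le_rfl] at h1
  rw [Column.unitOrZero_smul_apply (Fin.zero_le i), if_pos rfl] at h2
  rw [← h1, h2, ite_self]
  rfl

/-- There are modules outside the monomorphism category. -/
theorem exists_finite_notMem_monoCat [Nontrivial A] [Module.Finite R A] (hn : 2 ≤ n) :
    ∃ X : ModuleCat.{u} (UpperTri R A n), Module.Finite (UpperTri R A n) X ∧
      ¬ monoCat R A n X := by
  let o : Fin n := ⟨0, by omega⟩
  let l : Fin n := ⟨1, by omega⟩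
  have ho : ∀ j, o ≤ j := fun j => Fin.le_def.mpr (Nat.zero_le _)
  have hol : ¬ l ≤ o := fun h => absurd (Fin.le_def.mp h) (by simp [o, l])
  -- This module is zero at position 0 and `A` at position 1, so its map from branch 1 to branch 0
  -- is not injective.
  refine ⟨ModuleCat.of _ (tailColumn R A n A l),
    inferInstanceAs (Module.Finite _ (tailColumn R A n A l)), fun h => ?_⟩
  let x : Column R A n A := Column.of R A (Pi.single l 1)
  have hx : x l = 1 := Pi.single_eq_same (M := fun _ => A) l 1
  have h1 := ((mem_monoCat_iff ho).mp h).2 l ((headColumn R A n A l).mkQ x) (by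
    rw [← map_smul]
    refine tailColumn.mkQ_eq_iff.mpr fun j _ => ?_
    rw [Column.unitOrZero_smul_apply le_rfl]
    by_cases hj : j = l
    · subst hj
      rw [if_pos rfl]
    · rw [if_neg hj]
      exact (Pi.single_eq_of_ne (M := fun _ => A) hj 1).symm) (by
    rw [← map_smul, ← map_zero (headColumn R A n A l).mkQ]
    refine tailColumn.mkQ_eq_iff.mpr fun j hj => ?_
    rw [Column.unitOrZero_smul_apply (ho l), if_neg (fun h : j = o => hol (h ▸ hj))]
    rfl)
  rw [← map_zero (headColumn R A n A l).mkQ] at h1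
  have h2 := tailColumn.mkQ_eq_iff.mp h1 l le_rfl
  rw [hx] at h2
  exact one_ne_zero h2

end Finite

end MonomorphismCategory

/-! ### The resolution of `D(T_n(A))` and the cotilting property. -/

section Resolution

open CategoryTheory

theorem HasFiniteAddResolution.of_shortExact {Λ : Type u} [Ring Λ] {T Z K P : ModuleCat.{u} Λ}
    (f : K →ₗ[Λ] P) (g : P →ₗ[Λ] Z) (hf : Function.Injective f) (hg : Function.Surjective g)
    (hfg : Function.Exact f g) (hK : MemAdd K T) (hP : MemAdd P T) :
    HasFiniteAddResolution T Z := by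
  refine ⟨1, fun | 0 => P | 1 => K | _ + 2 => ModuleCat.of Λ PUnit.{u + 1},
    fun | 0 => f | _ + 1 => 0, g, ?_, ?_, hg, hfg, ?_⟩
  · intro i hi
    match i, hi with
    | 0, _ => exact hP
    | 1, _ => exact hK
  · intro i hi
    match i, hi with
    | i + 2, _ => exact inferInstanceAs (Subsingleton PUnit.{u + 1})
  · intro i
    match i with
    | 0 =>
      intro y
      change f y = 0 ↔ y ∈ Set.range (0 : PUnit.{u + 1} →ₗ[Λ] K)
      rw [map_eq_zero_iff f hf]
      constructor
      · rintro rfl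
        exact ⟨PUnit.unit, rfl⟩
      · rintro ⟨_, rfl⟩
        rfl
    | i + 1 =>
      intro y
      exact ⟨fun _ => ⟨PUnit.unit, Subsingleton.elim (α := PUnit.{u + 1}) _ _⟩,
        fun _ => rfl⟩

theorem memAdd_pi {Λ : Type u} [Ring Λ] {T : ModuleCat.{u} Λ} {n : ℕ} (N : Fin n → Type u)
    [∀ i, AddCommGroup (N i)] [∀ i, Module Λ (N i)]
    (h : ∀ i, IsDirectSummand (ModuleCat.of Λ (N i)) T) :
    MemAdd (ModuleCat.of Λ (∀ i, N i)) T := by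
  choose f g hfg using fun i => isDirectSummand_iff.mp (h i)
  exact memAdd_of_retract (k := n) (LinearMap.pi fun i => f i ∘ₗ LinearMap.proj i)
    (LinearMap.pi fun i => g i ∘ₗ LinearMap.proj i)
    fun x => funext fun i => LinearMap.congr_fun (hfg i) (x i)

variable {R A : Type u} [CommRing R] [Ring A] [Algebra R A] {n : ℕ}

section Summands

variable {M : Type u} [AddCommGroup M] [Module A M]

theorem isDirectSummand_mBranch (i : Fin n) :
    IsDirectSummand (ModuleCat.of _ (mBranch R A n M i)) (mModule R A n M) :=
  isDirectSummand_iff.mpr ⟨LinearMap.single _ (fun i => mBranch R A n M i) i, LinearMap.proj i,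
    LinearMap.ext fun x => Pi.single_eq_same (M := fun i => mBranch R A n M i) i x⟩

theorem isDirectSummand_headColumn (i : Fin n) :
    IsDirectSummand (ModuleCat.of _ (headColumn R A n M i)) (mModule R A n M) := by
  by_cases hi : i.1 = 0
  · rw [headColumn_eq_bot fun j => Fin.le_def.mpr (hi ▸ Nat.zero_le _)]
    exact isDirectSummand_iff.mpr ⟨0, 0, LinearMap.ext fun x => Subsingleton.elim _ _⟩
  · rw [headColumn_eq_mBranch (k := ⟨i.1 - 1, by omega⟩) (Nat.succ_pred_eq_of_ne_zero hi)]
    exact isDirectSummand_mBranch _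

theorem isDirectSummand_column [NeZero n] :
    IsDirectSummand (ModuleCat.of _ (Column R A n M)) (mModule R A n M) := by
  have hn := NeZero.pos n
  have hl : ∀ j : Fin n, j ≤ ⟨n - 1, by omega⟩ := fun j => Nat.le_sub_one_of_lt j.2
  obtain ⟨f, g, hfg⟩ := isDirectSummand_iff.mp
    (isDirectSummand_mBranch (R := R) (A := A) (n := n) (M := M) ⟨n - 1, by omega⟩)
  let e : Column R A n M ≃ₗ[UpperTri R A n] mBranch R A n M ⟨n - 1, by omega⟩ :=
    (LinearEquiv.ofTop _ (mBranch_eq_top hl)).symm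
  refine isDirectSummand_iff.mpr ⟨f ∘ₗ e.toLinearMap, e.symm.toLinearMap ∘ₗ g,
    LinearMap.ext fun x => ?_⟩
  have := LinearMap.congr_fun hfg (e x)
  exact (congrArg e.symm this).trans (e.symm_apply_apply x)

end Summands

theorem UpperTri.sum_diag_mul_unitOrZero (a : UpperTri R A n) :
    ∑ i, ∑ k, UpperTri.diag R A n (a.1 i k) * UpperTri.unitOrZero R A i k = a := by
  rw [← Finset.sum_congr rfl fun i _ => UpperTri.unitOrZero_mul (le_refl i) a, ← Finset.sum_mul]
  have : ∑ i : Fin n, UpperTri.unitOrZero R A i i = 1 := by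
    refine Subtype.ext ?_
    rw [AddSubmonoidClass.coe_finsetSum,
      Finset.sum_congr rfl fun i _ => UpperTri.coe_unitOrZero (R := R) (A := A) (le_refl i)]
    ext r c
    rw [Matrix.sum_apply]
    change _ = (1 : Matrix (Fin n) (Fin n) A) r c
    simp [Matrix.single_apply, Matrix.one_apply, ite_and]
  rw [this, one_mul]

theorem UpperTri.coe_diag_mul_unitOrZero_apply {i k : Fin n} (h : i ≤ k) (a : A) (r c : Fin n) :
    (UpperTri.diag R A n a * UpperTri.unitOrZero R A i k).1 r c =
      if i = r ∧ k = c then a else 0 := by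
  change ((Matrix.diagonal fun _ => a) * (UpperTri.unitOrZero R A i k).1 :
    Matrix (Fin n) (Fin n) A) r c = _
  rw [Matrix.diagonal_mul, UpperTri.coe_unitOrZero h, Matrix.single_apply, mul_ite, mul_one,
    mul_zero]

variable (R A n) in
/-- The linear functional on `T_n(A)` given by a family of columns over `D(A)`. -/
noncomputable def columnsToDual :
    (Fin n → Column R A n (DualRegular R A)) →ₗ[UpperTri R A n]
      DualRegular R (UpperTri R A n) where
  toFun v := DualRegular.toHom.symm
    { toFun := fun a => ∑ i, ∑ k, (v i k).toHom (a.1 i k)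
      map_add' := fun a b => by
        rw [← Finset.sum_add_distrib]
        refine Finset.sum_congr rfl fun i _ => ?_
        rw [← Finset.sum_add_distrib]
        exact Finset.sum_congr rfl fun k _ => map_add _ _ _
      map_smul' := fun r a => by
        rw [RingHom.id_apply, Finset.smul_sum]
        refine Finset.sum_congr rfl fun i _ => ?_
        rw [Finset.smul_sum]
        exact Finset.sum_congr rfl fun k _ => map_smul _ _ _ }
  map_add' v w := DualRegular.ext fun a => by
    change ∑ i, ∑ k, (v i k + w i k).toHom (a.1 i k) =
      ∑ i, ∑ k, (v i k).toHom (a.1 i k) + ∑ i, ∑ k, (w i k).toHom (a.1 i k)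
    rw [← Finset.sum_add_distrib]
    refine Finset.sum_congr rfl fun i _ => ?_
    rw [← Finset.sum_add_distrib]
    refine Finset.sum_congr rfl fun k _ => ?_
    rw [map_add, LinearMap.add_apply]
  map_smul' b v := DualRegular.ext fun a => by
    change ∑ i, ∑ j, ((b • v i) j).toHom (a.1 i j) =
      ∑ i, ∑ k, (v i k).toHom ((a.1 * b.1) i k)
    refine Finset.sum_congr rfl fun i _ => ?_
    have h1 : ∀ j, ((b • v i) j).toHom (a.1 i j) =
        ∑ k, (v i k).toHom (a.1 i j * b.1 j k) := fun j => by
      rw [Column.smul_apply, map_sum, LinearMap.sum_apply]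
      rfl
    have h2 : ∀ k, (v i k).toHom ((a.1 * b.1) i k) =
        ∑ j, (v i k).toHom (a.1 i j * b.1 j k) := fun k => by
      rw [Matrix.mul_apply, map_sum]
    rw [Finset.sum_congr rfl fun j _ => h1 j, Finset.sum_congr rfl fun k _ => h2 k,
      Finset.sum_comm]

theorem columnsToDual_apply (v : Fin n → Column R A n (DualRegular R A)) (a : UpperTri R A n) :
    (columnsToDual R A n v).toHom a = ∑ i, ∑ k, (v i k).toHom (a.1 i k) :=
  rfl

theorem columnsToDual_surjective : Function.Surjective (columnsToDual R A n) := by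
  intro f
  let L : Fin n → Fin n → A →ₗ[R] UpperTri R A n := fun i k =>
    { toFun := fun a => UpperTri.diag R A n a * UpperTri.unitOrZero R A i k
      map_add' := fun a b => by rw [map_add, add_mul]
      map_smul' := fun r a => by
        have : UpperTri.diag R A n (r • a) = r • UpperTri.diag R A n a := by
          refine Subtype.ext ?_
          change (Matrix.diagonal fun _ => r • a) = r • (Matrix.diagonal fun _ => a)
          rw [← Matrix.diagonal_smul]
          rfl
        rw [this, smul_mul_assoc]
        rfl }
  refine ⟨fun i => Column.of R A fun k => DualRegular.toHom.symm (f.toHom ∘ₗ L i k),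
    DualRegular.ext fun a => ?_⟩
  rw [columnsToDual_apply]
  conv_rhs => rw [← UpperTri.sum_diag_mul_unitOrZero a, map_sum]
  refine Finset.sum_congr rfl fun i _ => ?_
  rw [map_sum]
  rfl

/-- Entries `v i k` with `k < i` only meet the zeros below the diagonal; the others are tested on
the matrices `a e_{ik}`. -/
theorem columnsToDual_eq_zero_iff {v : Fin n → Column R A n (DualRegular R A)} :
    columnsToDual R A n v = 0 ↔ ∀ i, v i ∈ headColumn R A n (DualRegular R A) i := by
  constructor
  · intro h i k hik
    refine DualRegular.ext fun a => ?_
    have h1 : (columnsToDual R A n v).toHom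
        (UpperTri.diag R A n a * UpperTri.unitOrZero R A i k) = 0 := by
      rw [h]
      rfl
    rw [columnsToDual_apply, Finset.sum_eq_single i, Finset.sum_eq_single k,
      UpperTri.coe_diag_mul_unitOrZero_apply hik, if_pos ⟨rfl, rfl⟩] at h1
    · exact h1
    · intro c _ hc
      rw [UpperTri.coe_diag_mul_unitOrZero_apply hik, if_neg fun h => hc h.2.symm, map_zero]
    · exact fun h => absurd (Finset.mem_univ k) h
    · intro r _ hr
      refine Finset.sum_eq_zero fun c _ => ?_
      rw [UpperTri.coe_diag_mul_unitOrZero_apply hik, if_neg fun h => hr h.1.symm, map_zero]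
    · exact fun h => absurd (Finset.mem_univ i) h
  · intro h
    refine DualRegular.ext fun a => ?_
    rw [columnsToDual_apply]
    refine (Finset.sum_eq_zero fun i _ => Finset.sum_eq_zero fun k _ => ?_).trans rfl
    rcases lt_or_ge k i with hk | hk
    · rw [a.2 hk, map_zero]
    · rw [h i k hk]
      rfl

theorem hasFiniteAddResolution_mModule [NeZero n] :
    HasFiniteAddResolution (mModule R A n (DualRegular R A))
      (ModuleCat.of _ (DualRegular R (UpperTri R A n))) := by
  refine HasFiniteAddResolution.of_shortExact
    (K := ModuleCat.of _ (∀ i : Fin n, headColumn R A n (DualRegular R A) i))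
    (P := ModuleCat.of _ (Fin n → Column R A n (DualRegular R A)))
    (LinearMap.pi fun i => (headColumn R A n (DualRegular R A) i).subtype ∘ₗ LinearMap.proj i)
    (columnsToDual R A n) (fun v w hvw => funext fun i => Subtype.ext (congrFun hvw i))
    columnsToDual_surjective (fun v => ?_)
    (memAdd_pi _ isDirectSummand_headColumn) (memAdd_pi _ fun _ => isDirectSummand_column)
  rw [columnsToDual_eq_zero_iff]
  constructor
  · exact fun h => ⟨fun i => ⟨v i, h i⟩, rfl⟩
  · rintro ⟨w, rfl⟩ i
    exact (w i).2

variable [IsArtinianRing R]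

theorem monoCat_eq_leftPerp [NeZero n] :
    monoCat R A n = leftPerp (mModule R A n (DualRegular R A)) :=
  monoCat_eq_leftPerp_mModule fun _ _ _ _ hy => DualRegular.exists_hom_ne_zero hy

variable [Module.Finite R A]

theorem isCotilting_mModule [NeZero n] : IsCotilting R 1 (mModule R A n (DualRegular R A)) where
  finite := finite_mModule
  injectiveDimension_le := by
    have := hasInjectiveDimensionLE_mModule (R := R) (A := A) (n := n) (M := DualRegular R A)
    exact (injectiveDimension_le_iff _ 1).mpr this
  ext_self := by
    have h := mModule_mem_monoCat (R := R) (A := A) (n := n) (M := DualRegular R A)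
    rw [monoCat_eq_leftPerp] at h
    exact h.2
  resolution := hasFiniteAddResolution_mModule

/-- If `m(D(A))` were injective, all finitely generated modules would lie in its left perpendicular
category, that is, in `S_n(A)`. -/
theorem injectiveDimension_mModule [Nontrivial A] (hn : 2 ≤ n) :
    injectiveDimension (mModule R A n (DualRegular R A)) = 1 := by
  have : NeZero n := ⟨by omega⟩
  refine le_antisymm isCotilting_mModule.injectiveDimension_le
    ((injectiveDimension_ge_iff _ 1).mpr fun h => ?_)
  obtain ⟨X, hX, hX'⟩ := exists_finite_notMem_monoCat (R := R) (A := A) hn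
  refine hX' ?_
  rw [monoCat_eq_leftPerp]
  exact ⟨hX, fun i hi => HasInjectiveDimensionLT.subsingleton _ 1 i hi X⟩

end Resolution

/-! ### The endomorphism ring of `m(D(A))`. -/

section EndomorphismRing

open MulOpposite

variable {R A : Type u} [CommRing R] [Ring A] [Algebra R A] {n : ℕ}
  {M : Type u} [AddCommGroup M] [Module A M]

namespace mModule

/-- The entry at position `j` of the `c`-th summand. -/
def entry (t : mModule R A n M) (c j : Fin n) : M :=
  (t c).1 j

@[ext]
theorem ext {s t : mModule R A n M} (h : ∀ c j, entry s c j = entry t c j) : s = t :=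
  funext fun c => Subtype.ext (funext fun j => h c j)

theorem entry_of_lt (t : mModule R A n M) {c j : Fin n} (h : c < j) : entry t c j = 0 :=
  (t c).2 j h

theorem entry_add (s t : mModule R A n M) (c j : Fin n) :
    entry (s + t) c j = entry s c j + entry t c j :=
  rfl

theorem entry_smul (b : UpperTri R A n) (t : mModule R A n M) (c j : Fin n) :
    entry (b • t) c j = ∑ l, b.1 j l • entry t c l :=
  rfl

theorem entry_diag_smul (a : A) (t : mModule R A n M) (c j : Fin n) :
    entry (UpperTri.diag R A n a • t) c j = a • entry t c j :=
  Column.diag_smul_apply a (t c).1 j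

theorem entry_unitOrZero_smul {i j : Fin n} (h : i ≤ j) (t : mModule R A n M) (c k : Fin n) :
    entry (UpperTri.unitOrZero R A i j • t) c k = if k = i then entry t c j else 0 :=
  Column.unitOrZero_smul_apply h (t c).1 k

/-- Evaluation at an entry, as an additive map. -/
def entryHom (c j : Fin n) : mModule R A n M →+ M where
  toFun t := entry t c j
  map_zero' := rfl
  map_add' _ _ := rfl

theorem entry_sum {ι : Type*} (s : Finset ι) (t : ι → mModule R A n M) (c j : Fin n) :
    entry (∑ i ∈ s, t i) c j = ∑ i ∈ s, entry (t i) c j :=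
  map_sum (entryHom c j) t s

variable (R A) in
/-- The element of `m(M)` with given entries. -/
def of (x : Fin n → Fin n → M) (hx : ∀ c j, c < j → x c j = 0) : mModule R A n M :=
  fun c => ⟨Column.of R A (x c), fun j hj => hx c j hj⟩

theorem entry_of (x : Fin n → Fin n → M) (hx : ∀ c j, c < j → x c j = 0) (c j : Fin n) :
    entry (of R A x hx) c j = x c j :=
  rfl

variable (R A) in
/-- The element of `m(M)` with one nonzero entry. -/
def single {c j : Fin n} (h : j ≤ c) (u : M) : mModule R A n M :=
  of R A (fun c' j' => if c' = c ∧ j' = j then u else 0) fun c' j' hlt => if_neg (by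
    rintro ⟨rfl, rfl⟩
    exact absurd hlt (not_lt.mpr h))

theorem entry_single {c j : Fin n} (h : j ≤ c) (u : M) (c' j' : Fin n) :
    entry (single R A h u) c' j' = if c' = c ∧ j' = j then u else 0 :=
  rfl

variable (R) in
/-- Right multiplication by an upper triangular matrix on `m(M)`, regarded as a module of upper
triangular matrices over `M`, when `A` acts on `M` from the right by endomorphisms. -/
def rightMulHom (ρ : Aᵐᵒᵖ →+* Module.End A M) :
    (UpperTri R A n)ᵐᵒᵖ →+* Module.End (UpperTri R A n) (mModule R A n M) where
  toFun a :=
    -- The summand index is the column index: `entry t k j` stands in row `j` and column `k` of an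
    -- upper triangular matrix.
    { toFun := fun t => of R A (fun c j => ∑ k, ρ (op (a.unop.1 k c)) (entry t k j))
        fun c j hcj => Finset.sum_eq_zero fun k _ => by
          rcases lt_or_ge k j with hk | hk
          · rw [entry_of_lt t hk, map_zero]
          · rw [a.unop.2 (lt_of_lt_of_le hcj hk), op_zero, map_zero, LinearMap.zero_apply]
      map_add' := fun s t => ext fun c j => by
        rw [entry_add, entry_of, entry_of, entry_of, ← Finset.sum_add_distrib]
        exact Finset.sum_congr rfl fun k _ => map_add _ _ _
      map_smul' := fun b t => ext fun c j => by
        rw [RingHom.id_apply, entry_smul, entry_of]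
        have h1 : ∀ k, ρ (op (a.unop.1 k c)) (entry (b • t) k j) =
            ∑ l, b.1 j l • ρ (op (a.unop.1 k c)) (entry t k l) := fun k => by
          rw [entry_smul, map_sum]
          exact Finset.sum_congr rfl fun l _ => map_smul _ _ _
        rw [Finset.sum_congr rfl fun k _ => h1 k, Finset.sum_comm]
        refine Finset.sum_congr rfl fun l _ => ?_
        rw [entry_of, Finset.smul_sum] }
  map_one' := LinearMap.ext fun t => ext fun c j => by
    change ∑ k, ρ (op ((1 : Matrix (Fin n) (Fin n) A) k c)) (entry t k j) = entry t c j
    rw [Finset.sum_eq_single c]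
    · rw [Matrix.one_apply_eq, op_one, map_one, Module.End.one_apply]
    · intro k _ hk
      rw [Matrix.one_apply_ne hk, op_zero, map_zero, LinearMap.zero_apply]
    · exact fun h => absurd (Finset.mem_univ c) h
  map_mul' a b := LinearMap.ext fun t => ext fun c j => by
    change ∑ k, ρ (op ((b.unop.1 * a.unop.1) k c)) (entry t k j) =
      ∑ l, ρ (op (a.unop.1 l c)) (∑ k, ρ (op (b.unop.1 k l)) (entry t k j))
    have h1 : ∀ k, ρ (op ((b.unop.1 * a.unop.1) k c)) (entry t k j) =
        ∑ l, ρ (op (a.unop.1 l c)) (ρ (op (b.unop.1 k l)) (entry t k j)) := fun k => by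
      rw [Matrix.mul_apply, Finset.op_sum, map_sum, LinearMap.sum_apply]
      refine Finset.sum_congr rfl fun l _ => ?_
      rw [op_mul, map_mul, Module.End.mul_apply]
    rw [Finset.sum_congr rfl fun k _ => h1 k, Finset.sum_comm]
    exact Finset.sum_congr rfl fun l _ => (map_sum _ _ _).symm
  map_zero' := LinearMap.ext fun t => ext fun c j => by
    change ∑ k, ρ (op (0 : A)) (entry t k j) = 0
    rw [op_zero, map_zero]
    exact Finset.sum_eq_zero fun _ _ => rfl
  map_add' a b := LinearMap.ext fun t => ext fun c j => by
    change ∑ k, ρ (op (a.unop.1 k c + b.unop.1 k c)) (entry t k j) =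
      ∑ k, ρ (op (a.unop.1 k c)) (entry t k j) + ∑ k, ρ (op (b.unop.1 k c)) (entry t k j)
    rw [← Finset.sum_add_distrib]
    refine Finset.sum_congr rfl fun k _ => ?_
    rw [op_add, map_add, LinearMap.add_apply]

theorem entry_rightMulHom (ρ : Aᵐᵒᵖ →+* Module.End A M) (a : (UpperTri R A n)ᵐᵒᵖ)
    (t : mModule R A n M) (c j : Fin n) :
    entry (rightMulHom R ρ a t) c j = ∑ k, ρ (op (a.unop.1 k c)) (entry t k j) :=
  rfl

theorem rightMulHom_injective [NeZero n] {ρ : Aᵐᵒᵖ →+* Module.End A M}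
    (hρ : Function.Injective ρ) : Function.Injective (rightMulHom (n := n) R ρ) := by
  rw [injective_iff_map_eq_zero]
  intro a ha
  refine unop_injective (Subtype.ext (Matrix.ext fun k c => op_injective ?_))
  change op (a.unop.1 k c) = 0
  refine hρ (LinearMap.ext fun u => ?_)
  have h1 := entry_rightMulHom ρ a (single R A (Fin.zero_le k) u) c 0
  rw [ha, Finset.sum_eq_single k, entry_single, if_pos ⟨rfl, rfl⟩] at h1
  · rw [← h1, map_zero]
    rfl
  · intro l _ hl
    rw [entry_single, if_neg fun h => hl h.1, map_zero]
  · exact fun h => absurd (Finset.mem_univ k) h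

/-- Multiplication by `e_{0j}` moves row `j` to row 0, so `θ` is determined by its components `g k
c` on row 0, and each of these is the action of an element of `A`. -/
theorem rightMulHom_surjective [NeZero n] {ρ : Aᵐᵒᵖ →+* Module.End A M}
    (hρ : Function.Surjective ρ) : Function.Surjective (rightMulHom (n := n) R ρ) := by
  intro θ
  let g : Fin n → Fin n → M →ₗ[A] M := fun k c =>
    { toFun := fun u => entry (θ (single R A (Fin.zero_le k) u)) c 0
      map_add' := fun u v => by
        rw [← entry_add, ← map_add]
        refine congrArg (fun t => entry (θ t) c 0) (ext fun c' j' => ?_)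
        rw [entry_add, entry_single, entry_single, entry_single]
        split_ifs
        · rfl
        · rw [add_zero]
      map_smul' := fun a u => by
        rw [RingHom.id_apply, ← entry_diag_smul, ← map_smul]
        refine congrArg (fun t => entry (θ t) c 0) (ext fun c' j' => ?_)
        rw [entry_diag_smul, entry_single, entry_single, smul_ite, smul_zero] }
  have hg : ∀ k c u, g k c u = entry (θ (single R A (Fin.zero_le k) u)) c 0 := fun _ _ _ => rfl
  -- Triangularity: an entry at row 0, column `k` is `e_{0k}` times the same entry at row `k`, and
  -- summand `c` has no row `k` when `c < k`.
  have hg0 : ∀ k c, c < k → g k c = 0 := by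
    intro k c hck
    refine LinearMap.ext fun u => ?_
    have h1 : single R A (Fin.zero_le k) u =
        UpperTri.unitOrZero R A 0 k • single R A (le_refl k) u := ext fun c' j' => by
      rw [entry_unitOrZero_smul (Fin.zero_le k), entry_single, entry_single]
      by_cases hc : c' = k <;> by_cases hj : j' = 0 <;> simp [hc, hj]
    rw [hg, h1, map_smul, entry_unitOrZero_smul (Fin.zero_le k), if_pos rfl, entry_of_lt _ hck]
    rfl
  have hex : ∀ k c, ∃ a : A, ρ (op a) = g k c ∧ (c < k → a = 0) := by
    intro k c
    by_cases hck : c < k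
    · exact ⟨0, by rw [op_zero, map_zero, hg0 k c hck], fun _ => rfl⟩
    · obtain ⟨a, ha⟩ := hρ (g k c)
      exact ⟨a.unop, ha, fun h => absurd h hck⟩
  choose a ha ha0 using hex
  refine ⟨op ⟨Matrix.of a, fun k c h => ha0 k c h⟩, LinearMap.ext fun t => ext fun c j => ?_⟩
  rw [entry_rightMulHom]
  change ∑ k, ρ (op (a k c)) (entry t k j) = _
  have h1 : UpperTri.unitOrZero R A 0 j • t =
      ∑ k, single R A (Fin.zero_le k) (entry t k j) := ext fun c' j' => by
    rw [entry_unitOrZero_smul (Fin.zero_le j), entry_sum, Finset.sum_eq_single c', entry_single]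
    · simp
    · intro k _ hk
      rw [entry_single, if_neg fun h => hk h.1.symm]
    · exact fun h => absurd (Finset.mem_univ c') h
  have h2 : entry (θ t) c j = entry (θ (UpperTri.unitOrZero R A 0 j • t)) c 0 := by
    rw [map_smul, entry_unitOrZero_smul (Fin.zero_le j), if_pos rfl]
  rw [h2, h1, map_sum, entry_sum]
  exact Finset.sum_congr rfl fun k _ => by rw [ha, hg]

end mModule

/-- The right action of `Λ` on `D(Λ)`, as a ring homomorphism. -/
noncomputable def DualRegular.rightMulHom (R Λ : Type u) [CommRing R] [Ring Λ] [Algebra R Λ] :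
    Λᵐᵒᵖ →+* Module.End Λ (DualRegular R Λ) where
  toFun a := DualRegular.rightMul a.unop
  map_one' := LinearMap.ext fun f => DualRegular.ext fun x => congrArg f.toHom (one_mul x)
  map_mul' a b := LinearMap.ext fun f => DualRegular.ext fun x =>
    congrArg f.toHom (mul_assoc b.unop a.unop x)
  map_zero' := LinearMap.ext fun f => DualRegular.ext fun x =>
    (congrArg f.toHom (zero_mul x)).trans (map_zero _)
  map_add' a b := LinearMap.ext fun f => DualRegular.ext fun x =>
    (congrArg f.toHom (add_mul a.unop b.unop x)).trans (map_add _ _ _)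

theorem DualRegular.rightMulHom_bijective (R Λ : Type u) [CommRing R] [IsArtinianRing R] [Ring Λ]
    [Algebra R Λ] [Module.Finite R Λ] : Function.Bijective (DualRegular.rightMulHom R Λ) := by
  constructor
  · rw [injective_iff_map_eq_zero]
    intro a ha
    exact unop_injective (DualRegular.eq_zero_of_rightMul_eq_zero fun f => LinearMap.congr_fun ha f)
  · intro θ
    obtain ⟨a, rfl⟩ := DualRegular.exists_rightMul_eq θ
    exact ⟨op a, rfl⟩

end EndomorphismRing

theorem corollary3p2 (R A : Type u) [CommRing R] [IsArtinianRing R] [Ring A] [Algebra R A]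
    [Module.Finite R A] (n : ℕ) (hn : 2 ≤ n) :
    monoCat R A n = leftPerp (mModule R A n (DualRegular R A)) ∧
    IsCotilting R 1 (mModule R A n (DualRegular R A)) ∧
    (Nontrivial A →
      CategoryTheory.injectiveDimension (mModule R A n (DualRegular R A)) = 1) ∧
    Nonempty (Module.End (UpperTri R A n) (mModule R A n (DualRegular R A)) ≃+*
      (UpperTri R A n)ᵐᵒᵖ) ∧
    (∀ (r : ℕ) (C : ModuleCat.{u} (UpperTri R A n)), IsCotilting R r C →
      monoCat R A n = leftPerp C →
      ∀ N : ModuleCat.{u} (UpperTri R A n), IsIndecomposableModule N →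
        (IsDirectSummand N C ↔ IsDirectSummand N (mModule R A n (DualRegular R A)))) := by
  have : NeZero n := ⟨by omega⟩
  have hT := isCotilting_mModule (R := R) (A := A) (n := n)
  have hperp := monoCat_eq_leftPerp (R := R) (A := A) (n := n)
  refine ⟨hperp, hT, fun _ => injectiveDimension_mModule hn, ?_, fun r C hC hCperp N hN => ?_⟩
  · obtain ⟨hinj, hsurj⟩ := DualRegular.rightMulHom_bijective R A
    exact ⟨(RingEquiv.ofBijective (mModule.rightMulHom (n := n) R (DualRegular.rightMulHom R A))
      ⟨mModule.rightMulHom_injective hinj, mModule.rightMulHom_surjective hsurj⟩).symm⟩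
  · have h := hCperp.symm.trans hperp
    exact ⟨hC.isDirectSummand_of_leftPerp_eq hT h hN,
      hT.isDirectSummand_of_leftPerp_eq hC h.symm hN⟩
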